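/- All fields have characteristic zero. A difference field $(F,\sigma)$ is a field $F$ with an automorphism $\sigma$; its constant field is $C_F=\{c\in F\mid\sigma(c)=c\}$, and $\Delta(f)=\sigma(f)-f$. A complete reduction for a $C$-subspace $U$ of a $C$-vector space $V$ is a $C$-linear map $\phi:V\to V$ with $\ker\phi=U$ and $f-\phi(f)\in U$ for all $f\in V$. A $\Sigma^*$-tower over $(F_0,\sigma)$ is a difference field extension $(F_n,\sigma)$ with $F_n=F_0(t_1,\dots,t_n)$ such that, with $F_i=F_0(t_1,\dots,t_i)$, each $t_i$ is transcendental over $F_{i-1}$, $\Delta(t_i)\in F_{i-1}$, and $C_{F_n}=C_{F_0}$. Let $(F_0,\sigma)$ be a difference field with constant field $C$, let $\phi_0:F_0\to F_0$ be a complete reduction for $\Delta(F_0)$, and let $\Theta_0$ be a $C$-basis of $F_0$. For a $\Sigma^*$-tower $F_0(t_1,\dots,t_n)$ let $\Theta_i$ be the $F_{i-1}$-basis of $F_i$ consisting of all $t_i^k$ ($k\ge0$) and all $t_i^k/q^j$ with $q\in F_{i-1}[t_i]$ monic irreducible, $0\le k<\deg q$, $j\ge1$, and let $\Xi_i=\{\theta_0\theta_1\cdots\theta_i\mid\theta_j\in\Theta_j\}$,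 a $C$-basis of $F_i$. For $\theta\in\Xi_i$ let $\theta^*:F_i\to C$ be the coefficient of $\theta$ in the expansion with respect to $\Xi_i$, and let $\operatorname{ind}(f)$ be the least $j$ with $f\in F_j$. Complete reductions $\phi_i$ for $\Delta(F_i)$, $1\le i\le n$, are constructed recursively from $\phi_0$: choose a set $S_i$ of representatives of the monic irreducible polynomials in $F_{i-1}[t_i]$ modulo the relation $p\sim c\,\sigma^{\ell}(p)$ ($c\in F_{i-1}\setminus\{0\}$, $\ell\in\mathbb Z$), and an element $\theta_i\in\Xi_{i-1}$ with $\theta_i^*(\phi_{i-1}(\Delta(t_i)))\ne0$ and $\operatorname{ind}(\theta_i)=\operatorname{ind}(\phi_{i-1}(\Delta(t_i)))$; then $\phi_i$ is the complete reduction for $\Delta(F_i)$ on $F_i$ with image $U_i\oplus V_i$, where $U_i$ is the space of fractions in $F_{i-1}(t_i)$ with numerator degree less than denominator degree that have a product of elements of $S_i$ as denominator, and $V_i=\bigoplus_{k\ge0}\bigl(\operatorname{im}(\phi_{i-1})\cap\ker(\theta_i^*)\bigr)t_i^k$. Fix the choices of $S_i$ and $\theta_i$, arbitrarily, once and for all (for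 every difference field extension of $(F_0,\sigma)$ and every tuple $(t_1,\dots,t_i)$ of generators of a tower inside it). A $\Sigma^*$-tower $F_0(t_1,\dots,t_n)$ is called well generated if $\Delta(t_i)\in\operatorname{im}(\phi_{i-1})$ for all $1\le i\le n$. **Proposition.** Let $(F_n,\sigma)$ be a $\Sigma^*$-tower over $(F_0,\sigma)$ with $F_n=F_0(t_1,\dots,t_n)$. Then there exist a well generated $\Sigma^*$-tower $(K_n,\tilde\sigma)$ over $(F_0,\sigma)$ with $K_n=F_0(u_1,\dots,u_n)$ (in particular, the complete reductions $\phi_0,\dots,\phi_n$ of this tower exist) and a field isomorphism $\tau_n:F_n\to K_n$ with $\tau_n\circ\sigma=\tilde\sigma\circ\tau_n$ and $\tau_n|_{F_0}=\operatorname{id}$. -/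

import Mathlib

open Polynomial

universe u v w

namespace SigmaTower

/-- The constant field of the difference field `(F, σ)`. -/
def constants {F : Type u} [Field F] (σ : RingAut F) : Subfield F :=
  RingHom.eqLocusField (σ : F →+* F) (RingHom.id F)

/-- A `C`-linear operator `φ : V → V` is a complete reduction for `U` if `f - φ f ∈ U` for all `f`
and `ker φ = U` (so that `U` is a subspace). -/
def IsCompleteReduction {C : Type u} {V : Type v} [Field C] [AddCommGroup V] [Module C V]
    (U : Set V) (φ : V →ₗ[C] V) : Prop :=
  (∀ f, f - φ f ∈ U) ∧ (LinearMap.ker φ : Set V) = U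

/-- The summable space `Δ(F) = {σ g - g | g ∈ F}` of a difference field `(F, σ)`. -/
def summable {F : Type u} [Field F] (σ : RingAut F) : Set F :=
  {f | ∃ g, f = σ g - g}

/-- `θ^*(f) = c`: in the expansion of `f` in the basis `B`, the basis element `θ` has the
coefficient `c`. -/
def HasCoord (C : Type u) {V : Type v} [Field C] [AddCommGroup V] [Module C V]
    (B : Set V) (θ f : V) (c : C) : Prop :=
  ∃ l ∈ Finsupp.supported C C B, Finsupp.linearCombination C id l = f ∧ l θ = c

section OneStep

/- `L` is a subfield of `K` and `t ∈ K` is transcendental over `L`; the rational function field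
`L(t)` is the subfield of `K` generated by `t` over `L`, and polynomials in `L[t]` are the elements
`aeval t p`. -/

variable {F₀ : Type u} {K : Type v} [Field F₀] [Field K] [Algebra F₀ K]

/-- The summable space `Δ(L) = {σ g - g | g ∈ L}` of a subfield `L` of `(K, σ)`. -/
def summableIn (σ : RingAut K) (L : IntermediateField F₀ K) : Set L :=
  {f | ∃ g : L, (f : K) = σ (g : K) - (g : K)}

/-- The set `M_t` of monic irreducible polynomials in `L[t]`. -/
def monicIrreducibles (L : IntermediateField F₀ K) (t : K) : Set K :=
  {x | ∃ q : L[X], q.Monic ∧ Irreducible q ∧ x = aeval t q}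

/-- `p` and `q` are `σ`-equivalent: `p = c σ^ℓ(q)` with `c ∈ L`, `c ≠ 0`, `ℓ ∈ ℤ`. -/
def SigmaEquiv (σ : RingAut K) (L : IntermediateField F₀ K) (p q : K) : Prop :=
  ∃ c : L, c ≠ 0 ∧ ∃ ℓ : ℤ, p = (c : K) * (σ ^ ℓ) q

/-- `S` is a set of representatives of the `σ`-equivalence classes on `M_t`. -/
def IsRepresentatives (σ : RingAut K) (L : IntermediateField F₀ K) (t : K) (S : Set K) : Prop :=
  S ⊆ monicIrreducibles L t ∧
    ∀ q ∈ monicIrreducibles L t, ∃! p, p ∈ S ∧ SigmaEquiv σ L p q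

/-- The set `L(t)_(r)` of `t`-proper rational functions. -/
def properFractions (L : IntermediateField F₀ K) (t : K) : Set K :=
  {f | ∃ a b : L[X], b.Monic ∧ IsCoprime a b ∧ a.degree < b.degree ∧
    f = aeval t a / aeval t b}

/-- The space `U_S` of `t`-proper fractions `a / (p₁ ^ m₁ ⋯ p_l ^ m_l)` with `p_i ∈ S`. -/
def properComplement (L : IntermediateField F₀ K) (t : K) (S : Set K) : Set K :=
  {f | f ∈ properFractions L t ∧ ∃ a : L[X], ∃ d ∈ Submonoid.closure S, f = aeval t a / d}

/-- The `θ`-complement `V_θ = ⨁ₖ (im φ ∩ ker θ^*) t ^ k`, where `θ` is an element of the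
`C`-basis `B` of `L`. -/
def polyComplement {C : Type w} [Field C] [Algebra C F₀] [Algebra C K] [IsScalarTower C F₀ K]
    (L : IntermediateField F₀ K) (t : K) (φ : L →ₗ[C] L) (B : Set K) (θ : K) : Set K :=
  {f | ∃ p : L[X], (∀ k, p.coeff k ∈ LinearMap.range φ ∧ HasCoord C B θ (p.coeff k : K) 0) ∧
    f = aeval t p}

/-- The canonical `L`-basis of `L(t)` that comes from irreducible partial fractions. -/
def canonicalStep (L : IntermediateField F₀ K) (t : K) : Set K :=
  {x | ∃ k : ℕ, x = t ^ k} ∪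
  {x | ∃ q : L[X], q.Monic ∧ Irreducible q ∧ ∃ k j : ℕ, k < q.natDegree ∧ 1 ≤ j ∧
    x = t ^ k / (aeval t q) ^ j}

end OneStep

section Tower

variable {F₀ : Type u} {K : Type v} [Field F₀] [Field K] [Algebra F₀ K]

/-- The field `F_i = F₀(t₁, …, t_i)`, where `t₁, …, t_n` are the entries of `t : Fin n → K`. -/
def stage (F₀ : Type u) {K : Type v} [Field F₀] [Field K] [Algebra F₀ K] {n : ℕ}
    (t : Fin n → K) (i : ℕ) : IntermediateField F₀ K :=
  IntermediateField.adjoin F₀ {x | ∃ j : Fin n, (j : ℕ) < i ∧ x = t j}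

/-- `(K, σ)` with `K = F₀(t₁, …, t_n)` is a `Σ*`-tower over `(F₀, σ₀)`: a difference field
extension in which each `t_i` is transcendental over `F_{i-1}` with `σ t_i - t_i ∈ F_{i-1}`, and
which has the same constants as `(F₀, σ₀)`. -/
structure IsSigmaTower (σ₀ : RingAut F₀) (σ : RingAut K) {n : ℕ} (t : Fin n → K) : Prop where
  extends_base : ∀ x : F₀, σ (algebraMap F₀ K x) = algebraMap F₀ K (σ₀ x)
  transcendental : ∀ i : Fin n, Transcendental (stage F₀ t i) (t i)
  delta_mem : ∀ i : Fin n, σ (t i) - t i ∈ stage F₀ t i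
  generates : stage F₀ t n = ⊤
  constants_eq : ∀ f : K, σ f = f → ∃ c ∈ constants σ₀, algebraMap F₀ K c = f

/-- The element `Δ(t_i) = σ t_i - t_i` of `F_{i-1}`. -/
def IsSigmaTower.delta {σ₀ : RingAut F₀} {σ : RingAut K} {n : ℕ} {t : Fin n → K}
    (h : IsSigmaTower σ₀ σ t) (i : Fin n) : stage F₀ t i :=
  ⟨σ (t i) - t i, h.delta_mem i⟩

/-- The `Θ₀`-canonical basis `{θ₀ θ₁ ⋯ θ_i | θ_j ∈ Θ_j}` of `F_i`, where `Θ_j` is the canonical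
`F_{j-1}`-basis of `F_j`. -/
def canonicalBasis (Θ₀ : Set F₀) {n : ℕ} (t : Fin n → K) : ℕ → Set K
  | 0 => algebraMap F₀ K '' Θ₀
  | i + 1 =>
    if h : i < n then
      Set.image2 (· * ·) (canonicalBasis Θ₀ t i) (canonicalStep (stage F₀ t i) (t ⟨i, h⟩))
    else canonicalBasis Θ₀ t i

/-- The indicator of `f`: the least `i` with `f ∈ F_i`. -/
noncomputable def indicator (F₀ : Type u) {K : Type v} [Field F₀] [Field K] [Algebra F₀ K]
    {n : ℕ} (t : Fin n → K) (f : K) : ℕ :=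
  sInf {i | f ∈ stage F₀ t i}

/-- `θ` is an element of the `Θ₀`-canonical basis of `F_i` that is effective for `r`
(that is, `θ^*(r) ≠ 0`) and has the same indicator as `r`. -/
def IsEffective (σ₀ : RingAut F₀) (Θ₀ : Set F₀) {n : ℕ} (t : Fin n → K) (i : ℕ)
    (r θ : K) : Prop :=
  θ ∈ canonicalBasis Θ₀ t i ∧
  (∃ c : constants σ₀, c ≠ 0 ∧ HasCoord (constants σ₀) (canonicalBasis Θ₀ t i) θ r c) ∧
  indicator F₀ t θ = indicator F₀ t r

/-- The initial segment `(t₁, …, t_{i+1})` of `(t₁, …, t_n)` (0-based: the entries up to `t i`). -/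
def initialSegment {n : ℕ} (t : Fin n → K) (i : Fin n) : Fin ((i : ℕ) + 1) → K :=
  fun j => t (Fin.castLE i.isLt j)

end Tower

/-- The construction of complete reductions in a tower leaves two things open for each generator
`t_{m+1}` over `F_m = F₀(t₁, …, t_m)`: the set of representatives of the `σ`-equivalence classes of
monic irreducible polynomials in `F_m[t_{m+1}]`, and the basis element effective for
`r = φ_m(Δ(t_{m+1}))`. A `Selection` fixes these choices, in an arbitrary way, for all towers
`(t₁, …, t_{m+1})` in all difference fields `(K, σ)` above `F₀`. It is only required to select an
admissible object whenever there is one. -/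
structure Selection {F₀ : Type u} [Field F₀] (σ₀ : RingAut F₀) (Θ₀ : Set F₀) where
  reps : ∀ {K : Type v} [Field K] [Algebra F₀ K], RingAut K → ∀ {m : ℕ}, (Fin (m + 1) → K) → Set K
  elt : ∀ {K : Type v} [Field K] [Algebra F₀ K], RingAut K → ∀ {m : ℕ}, (Fin (m + 1) → K) → K → K
  reps_spec : ∀ {K : Type v} [Field K] [Algebra F₀ K] (σ : RingAut K) {m : ℕ}
    (t : Fin (m + 1) → K),
    (∃ S, IsRepresentatives σ (stage F₀ t m) (t (Fin.last m)) S) →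
      IsRepresentatives σ (stage F₀ t m) (t (Fin.last m)) (reps σ t)
  elt_spec : ∀ {K : Type v} [Field K] [Algebra F₀ K] (σ : RingAut K) {m : ℕ}
    (t : Fin (m + 1) → K) (r : K),
    (∃ θ, IsEffective σ₀ Θ₀ t m r θ) → IsEffective σ₀ Θ₀ t m r (elt σ t r)

section Reductions

variable {F₀ : Type u} {K : Type v} [Field F₀] [Field K] [Algebra F₀ K]

/-- `φ₀, φ₁, …, φ_n` are the complete reductions for `Δ(F₀), …, Δ(F_n)` in a `Σ*`-tower: the first
one is the given one on `F₀`, and `φ_i` is the complete reduction for `Δ(F_i)` that establishes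
`F_i = Δ(F_i) ⊕ U_S ⊕ V_θ`, where `S` is the selected set of representatives in `F_{i-1}[t_i]` and
`θ` is the selected basis element effective for `φ_{i-1}(Δ(t_i))`. -/
structure IsTowerReduction {σ₀ : RingAut F₀} {Θ₀ : Set F₀}
    (φ₀ : F₀ →ₗ[constants σ₀] F₀) (sel : Selection.{u, v} σ₀ Θ₀) {σ : RingAut K} {n : ℕ}
    {t : Fin n → K} (ht : IsSigmaTower σ₀ σ t)
    (φ : ∀ i : ℕ, stage F₀ t i →ₗ[constants σ₀] stage F₀ t i) : Prop where
  base : ∀ f : F₀, φ 0 (algebraMap F₀ (stage F₀ t 0) f) = algebraMap F₀ (stage F₀ t 0) (φ₀ f)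
  representatives : ∀ i : Fin n,
    IsRepresentatives σ (stage F₀ t i) (t i) (sel.reps σ (initialSegment t i))
  effective : ∀ i : Fin n,
    IsEffective σ₀ Θ₀ t i (φ i (ht.delta i))
      (sel.elt σ (initialSegment t i) (φ i (ht.delta i)))
  complete : ∀ i : Fin n,
    IsCompleteReduction (summableIn σ (stage F₀ t ((i : ℕ) + 1))) (φ ((i : ℕ) + 1))
  image_eq : ∀ i : Fin n,
    {x : K | ∃ y ∈ LinearMap.range (φ ((i : ℕ) + 1)), (y : K) = x} =
      Set.image2 (· + ·)
        (properComplement (stage F₀ t i) (t i) (sel.reps σ (initialSegment t i)))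
        (polyComplement (stage F₀ t i) (t i) (φ i) (canonicalBasis Θ₀ t i)
          (sel.elt σ (initialSegment t i) (φ i (ht.delta i))))

/-- A `Σ*`-tower is well generated if `Δ(t_i) ∈ im φ_{i-1}` for each `i`, where `φ₀, …, φ_n` are
its complete reductions. -/
def IsWellGenerated {σ₀ : RingAut F₀} {Θ₀ : Set F₀}
    (φ₀ : F₀ →ₗ[constants σ₀] F₀) (sel : Selection.{u, v} σ₀ Θ₀) {σ : RingAut K} {n : ℕ}
    {t : Fin n → K} (ht : IsSigmaTower σ₀ σ t) : Prop :=
  ∃ φ : ∀ i : ℕ, stage F₀ t i →ₗ[constants σ₀] stage F₀ t i,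
    IsTowerReduction φ₀ sel ht φ ∧ ∀ i : Fin n, ht.delta i ∈ LinearMap.range (φ i)

end Reductions

end SigmaTower

/-!
If `φ` is a complete reduction for `Δ(L)` and `t` is a `Σ*`-generator over `L`, then
`Δ(t) - φ(Δ(t)) = Δ(g)` for some `g ∈ L`, so that `t - g` has the reduced difference `φ(Δ(t))`.
Such a change of generators is triangular and hence preserves all the fields `F_i`: the given tower
becomes well generated after replacing its generators one after the other, and `τ` is the identity.

What has to be proved is that the complete reductions exist, that is,
`L(t) = Δ(L(t)) ⊕ U_S ⊕ V_θ`. For the proper fractions, an irreducible pole of `g` that is extremal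
in its `σ`-orbit survives in `Δ(g)`; since orbits are infinite in characteristic zero, `Δ(g)` has
poles at two points of an orbit, while `S` contains only one. For the polynomials, one reduces from
the leading coefficient downwards: modulo `Δ(L[t])` the coefficient of `t ^ k` can be changed by
`Δ(L)` and by the constant multiples of `Δ(t)`, the latter coming from `c t ^ (k + 1)`, and
`im φ ∩ ker θ^*` is a complement of the span of both.
-/

namespace SigmaTower

theorem apply_zpow_smul {G H α β : Type*} [Group G] [Group H] [MulAction G α] [MulAction H β]
    {g : G} {h : H} {f : α → β} (hf : ∀ x, f (g • x) = h • f x) (ℓ : ℤ) (x : α) :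
    f (g ^ ℓ • x) = h ^ ℓ • f x := by
  have hinv (x : α) : f (g⁻¹ • x) = h⁻¹ • f x := by rw [eq_inv_smul_iff, ← hf, smul_inv_smul]
  induction ℓ generalizing x with
  | zero => simp only [zpow_zero, one_smul]
  | succ k ih => rw [zpow_add_one, zpow_add_one, mul_smul, mul_smul, ih, hf]
  | pred k ih => rw [zpow_sub_one, zpow_sub_one, mul_smul, mul_smul, ih, hinv]

section Twist

variable {L : Type*} [CommRing L]

/-- The automorphism of `L[X]` that acts as `s` on `L` and maps `X` to `X + β`. It describes the
action of a shift operator on polynomials in a `Σ*`-generator `t` with `Δ(t) = β`. -/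
noncomputable def twist (s : RingAut L) (β : L) : RingAut L[X] :=
  (Polynomial.mapEquiv s).trans (taylorEquiv β).toRingEquiv

variable (s : RingAut L) (β : L)

theorem twist_apply (p : L[X]) : twist s β p = taylor β (p.map (s : L →+* L)) := rfl

theorem degree_twist (p : L[X]) : (twist s β p).degree = p.degree := by
  rw [twist_apply, degree_taylor, degree_map_eq_of_injective s.injective]

theorem natDegree_twist (p : L[X]) : (twist s β p).natDegree = p.natDegree :=
  natDegree_eq_natDegree (degree_twist s β p)

theorem leadingCoeff_twist (p : L[X]) : (twist s β p).leadingCoeff = s p.leadingCoeff := by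
  rw [twist_apply, leadingCoeff_taylor, leadingCoeff_map_of_injective s.injective,
    RingHom.coe_coe]

theorem coeff_twist {p : L[X]} {n : ℕ} (hp : p.natDegree ≤ n + 1) :
    (twist s β p).coeff n = s (p.coeff n) + (n + 1) * β * s (p.coeff (n + 1)) := by
  rw [twist_apply, taylor_apply, comp,
    eval₂_eq_sum_range' (n := n + 2) _ (Nat.lt_succ_of_le (natDegree_map_le.trans hp)),
    finsetSum_coeff, Finset.sum_range_succ, Finset.sum_range_succ, Finset.sum_eq_zero]
  · simp only [coeff_C_mul, coeff_X_add_C_pow, coeff_map, RingHom.coe_coe, Nat.sub_self, pow_zero,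
      Nat.choose_self, Nat.add_sub_cancel_left, pow_one, Nat.choose_succ_self_right]
    push_cast
    ring
  · intro i hi
    simp only [coeff_C_mul, coeff_X_add_C_pow, Nat.choose_eq_zero_of_lt (Finset.mem_range.1 hi),
      Nat.cast_zero, mul_zero]

theorem coeff_twist_of_natDegree_le {p : L[X]} {n : ℕ} (hp : p.natDegree ≤ n) :
    (twist s β p).coeff n = s (p.coeff n) := by
  rw [coeff_twist s β (hp.trans n.le_succ), coeff_eq_zero_of_natDegree_lt (Nat.lt_succ_of_le hp),
    map_zero, mul_zero, add_zero]

theorem degree_zpow_twist (p : L[X]) (ℓ : ℤ) : ((twist s β ^ ℓ) p).degree = p.degree := by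
  simpa using apply_zpow_smul (g := twist s β) (h := (1 : Equiv.Perm (WithBot ℕ)))
    (degree_twist s β) ℓ p

theorem monic_zpow_twist {p : L[X]} (hp : p.Monic) (ℓ : ℤ) : ((twist s β ^ ℓ) p).Monic := by
  simpa [Monic, hp.leadingCoeff] using
    apply_zpow_smul (g := twist s β) (h := s) (leadingCoeff_twist s β) ℓ p

theorem irreducible_zpow_twist {p : L[X]} (hp : Irreducible p) (ℓ : ℤ) :
    Irreducible ((twist s β ^ ℓ) p) :=
  (MulEquiv.irreducible_iff (twist s β ^ ℓ)).2 hp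

end Twist

section Shift

variable {L K : Type*} [CommRing L]

/-- `t` is a shift generator of `K` over `L` with `Δ(t) = β`: the automorphism `σ` extends `s` and
maps `t` to `t + β`. -/
structure IsShift [CommRing K] [Algebra L K] (s : RingAut L) (β : L) (σ : RingAut K) (t : K) :
    Prop where
  base : ∀ c : L, σ (algebraMap L K c) = algebraMap L K (s c)
  gen : σ t = t + algebraMap L K β

theorem IsShift.map_aeval [CommRing K] [Algebra L K] {s : RingAut L} {β : L} {σ : RingAut K}
    {t : K} (h : IsShift s β σ t) (p : L[X]) : σ (aeval t p) = aeval t (twist s β p) := by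
  induction p using Polynomial.induction_on' with
  | add p q hp hq => simp only [map_add, hp, hq]
  | monomial n a =>
    simp only [twist_apply, map_monomial, taylor_monomial, aeval_monomial, map_mul, map_pow,
      map_add, h.base, h.gen, aeval_C, aeval_X, RingHom.coe_coe]

theorem IsShift.zpow_aeval [CommRing K] [Algebra L K] {s : RingAut L} {β : L} {σ : RingAut K}
    {t : K} (h : IsShift s β σ t) (p : L[X]) (ℓ : ℤ) :
    (σ ^ ℓ) (aeval t p) = aeval t ((twist s β ^ ℓ) p) :=
  (apply_zpow_smul (g := twist s β) (h := σ) (fun p => (h.map_aeval p).symm) ℓ p).symm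

variable [Field K] [Algebra L K] {t : K}

theorem aeval_ne_zero (ht : Transcendental L t) {p : L[X]} (hp : p ≠ 0) : aeval t p ≠ 0 :=
  fun h => hp (transcendental_iff.1 ht p h)

theorem aeval_inj (ht : Transcendental L t) {p q : L[X]} : aeval t p = aeval t q ↔ p = q :=
  (transcendental_iff_injective.1 ht).eq_iff

theorem aeval_ne_zero_of_not_dvd (ht : Transcendental L t) {q b : L[X]} (hb : ¬ q ∣ b) :
    aeval t b ≠ 0 :=
  aeval_ne_zero ht fun h => hb (h ▸ dvd_zero q)

/-- The element `f` of `L(t)` has no pole at `q`: it is a fraction in `t` whose denominator is not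
divisible by `q`. The fraction need not be reduced. -/
def IsRegularAt (t : K) (q : L[X]) (f : K) : Prop :=
  ∃ a b : L[X], ¬ q ∣ b ∧ f = aeval t a / aeval t b

theorem IsRegularAt.neg {q : L[X]} {f : K} (hf : IsRegularAt t q f) : IsRegularAt t q (-f) := by
  obtain ⟨a, b, hb, rfl⟩ := hf
  exact ⟨-a, b, hb, by rw [map_neg, neg_div]⟩

theorem IsRegularAt.add (ht : Transcendental L t) {q : L[X]} (hq : Prime q) {f g : K}
    (hf : IsRegularAt t q f) (hg : IsRegularAt t q g) : IsRegularAt t q (f + g) := by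
  obtain ⟨a, b, hb, rfl⟩ := hf
  obtain ⟨c, d, hd, rfl⟩ := hg
  refine ⟨a * d + b * c, b * d, fun h => (hq.dvd_or_dvd h).elim hb hd, ?_⟩
  rw [div_add_div _ _ (aeval_ne_zero_of_not_dvd ht hb) (aeval_ne_zero_of_not_dvd ht hd), map_add,
    map_mul, map_mul, map_mul]

theorem IsShift.isRegularAt_iff {s : RingAut L} {β : L} {σ : RingAut K} (h : IsShift s β σ t)
    {q : L[X]} {f : K} : IsRegularAt t (twist s β q) (σ f) ↔ IsRegularAt t q f := by
  have hdiv (a b : L[X]) :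
      σ (aeval t a / aeval t b) = aeval t (twist s β a) / aeval t (twist s β b) := by
    rw [map_div₀, h.map_aeval, h.map_aeval]
  constructor
  · rintro ⟨a, b, hb, hf⟩
    obtain ⟨a, rfl⟩ := (twist s β).surjective a
    obtain ⟨b, rfl⟩ := (twist s β).surjective b
    rw [map_dvd_iff] at hb
    exact ⟨a, b, hb, σ.injective (hf.trans (hdiv a b).symm)⟩
  · rintro ⟨a, b, hb, rfl⟩
    exact ⟨twist s β a, twist s β b, by rwa [map_dvd_iff], hdiv a b⟩

theorem IsShift.isRegularAt_twist_iff_of_delta (ht : Transcendental L t) {s : RingAut L} {β : L}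
    {σ : RingAut K} (h : IsShift s β σ t) {q : L[X]} (hq : Prime (twist s β q)) {g : K}
    (hg : IsRegularAt t (twist s β q) (σ g - g)) :
    IsRegularAt t (twist s β q) g ↔ IsRegularAt t q g := by
  rw [← h.isRegularAt_iff (q := q)]
  constructor
  · intro hr
    simpa only [sub_add_cancel] using hg.add ht hq hr
  · intro hr
    simpa only [neg_sub, add_sub_cancel] using hr.add ht hq hg.neg

end Shift

section Poles

variable {L K : Type*} [Field L] [Field K] [Algebra L K] {t : K}

theorem finite_monic_dvd {b : L[X]} (hb : b ≠ 0) : {q : L[X] | q.Monic ∧ q ∣ b}.Finite :=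
  @Set.toFinite _ _ (fintypeSubtypeMonicDvd b hb).finite

theorem aeval_eq_algebraMap_iff (ht : Transcendental L t) {p : L[X]} {c : L} :
    aeval t p = algebraMap L K c ↔ p = C c := by
  rw [← aeval_C t c, aeval_inj ht]

theorem IsShift.pow_succ_twist_ne (ht : Transcendental L t) {s : RingAut L} {β : L}
    {σ : RingAut K} (h : IsShift s β σ t)
    (hc : ∀ f : K, σ f = f → ∃ c : L, algebraMap L K c = f) {q : L[X]} (hm : q.Monic)
    (hq : 0 < q.natDegree) (k : ℕ) : (twist s β ^ (k + 1)) q ≠ q := by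
  intro hk
  -- The product over a periodic orbit would be a non-constant polynomial fixed by `σ`.
  set x := ∏ i ∈ Finset.range (k + 1), (twist s β ^ i) q with hx
  have hfix : twist s β x = x := by
    simp only [hx, map_prod, ← RingAut.mul_apply, ← pow_succ']
    rw [Finset.prod_range_succ, hk, Finset.prod_range_succ', pow_zero, RingAut.one_apply]
  obtain ⟨c, hcx⟩ := hc (aeval t x) (by rw [h.map_aeval, hfix])
  have hxc : x = C c := (aeval_eq_algebraMap_iff ht).1 hcx.symm
  have hx0 : x ≠ 0 := Finset.prod_ne_zero_iff.2 fun i _ => by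
    rw [Ne, EmbeddingLike.map_eq_zero_iff]; exact hm.ne_zero
  have hdvd : q ∣ x := Finset.dvd_prod_of_mem (fun i => (twist s β ^ i) q) (a := 0) (by simp)
  have hle := natDegree_le_of_dvd hdvd hx0
  rw [hxc, natDegree_C] at hle
  omega

theorem IsShift.injective_zpow_twist (ht : Transcendental L t) {s : RingAut L} {β : L}
    {σ : RingAut K} (h : IsShift s β σ t)
    (hc : ∀ f : K, σ f = f → ∃ c : L, algebraMap L K c = f) {q : L[X]} (hm : q.Monic)
    (hq : 0 < q.natDegree) : Function.Injective fun ℓ : ℤ => (twist s β ^ ℓ) q := by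
  have not_lt_of_eq {i j : ℤ} (hij : (twist s β ^ i) q = (twist s β ^ j) q) :
      ¬ i < j := fun hlt => by
    obtain ⟨k, hk⟩ := Int.lt.dest hlt
    refine h.pow_succ_twist_ne ht hc hm hq k ((twist s β ^ i).injective ?_)
    rw [hij, ← hk, ← zpow_natCast, ← RingAut.mul_apply, ← zpow_add]
  exact fun i j hij => le_antisymm (not_lt.1 (not_lt_of_eq hij.symm)) (not_lt.1 (not_lt_of_eq hij))

theorem finite_not_isRegularAt (a : L[X]) {b : L[X]} (hb : b ≠ 0) :
    {q : L[X] | q.Monic ∧ ¬ IsRegularAt t q (aeval t a / aeval t b)}.Finite :=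
  (finite_monic_dvd hb).subset fun _ hq => ⟨hq.1, by_contra fun hdvd => hq.2 ⟨a, b, hdvd, rfl⟩⟩

theorem exists_boundary_of_finite {Z : Set ℤ} (hZ : Z.Finite) (hne : Z.Nonempty) :
    ∃ m ∈ Z, ∃ M ∈ Z, m ≤ M ∧ m - 1 ∉ Z ∧ M + 1 ∉ Z := by
  obtain ⟨m, hm, hmin⟩ := hZ.exists_minimalFor id Z hne
  obtain ⟨M, hM, hmax⟩ := hZ.exists_maximalFor id Z hne
  refine ⟨m, hm, M, hM, ?_, fun h => ?_, fun h => ?_⟩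
  · exact (le_total m M).elim id fun hle => hmax hm hle
  · exact (sub_one_lt m).not_ge (hmin h (sub_one_lt m).le)
  · exact (lt_add_one M).not_ge (hmax h (lt_add_one M).le)

theorem IsShift.exists_two_poles_delta (ht : Transcendental L t) {s : RingAut L} {β : L}
    {σ : RingAut K} (h : IsShift s β σ t)
    (hc : ∀ f : K, σ f = f → ∃ c : L, algebraMap L K c = f) {q : L[X]} (hm : q.Monic)
    (hq : Irreducible q) (a : L[X]) {b : L[X]} (hb : b ≠ 0) {g : K}
    (hg : g = aeval t a / aeval t b) (hpole : ¬ IsRegularAt t q g) :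
    ∃ k ℓ : ℤ, (twist s β ^ k) q ≠ (twist s β ^ ℓ) q ∧
      ¬ IsRegularAt t ((twist s β ^ k) q) (σ g - g) ∧
      ¬ IsRegularAt t ((twist s β ^ ℓ) q) (σ g - g) := by
  have hinj := h.injective_zpow_twist ht hc hm hq.natDegree_pos
  have hfin : {k : ℤ | ¬ IsRegularAt t ((twist s β ^ k) q) g}.Finite :=
    ((finite_not_isRegularAt a hb).preimage hinj.injOn).subset fun k hk =>
      ⟨monic_zpow_twist s β hm k, hg ▸ hk⟩
  obtain ⟨m, hpm, M, hpM, hmM, hrm, hrM⟩ := exists_boundary_of_finite hfin ⟨0, hpole⟩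
  have hsucc (k : ℤ) (hr : IsRegularAt t ((twist s β ^ (k + 1)) q) (σ g - g)) :
      IsRegularAt t ((twist s β ^ (k + 1)) q) g ↔ IsRegularAt t ((twist s β ^ k) q) g := by
    have hprime := (irreducible_zpow_twist s β hq (k + 1)).prime
    rw [add_comm, zpow_one_add, RingAut.mul_apply] at hr hprime ⊢
    exact h.isRegularAt_twist_iff_of_delta ht hprime hr
  refine ⟨m, M + 1, hinj.ne (by omega), fun hr => hpm ?_, fun hr => hpM ?_⟩
  · rw [← sub_add_cancel m 1] at hr ⊢
    exact (hsucc (m - 1) hr).2 (not_not.1 hrm)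
  · exact (hsucc M hr).1 (not_not.1 hrM)

theorem isUnit_of_isRegularAt (ht : Transcendental L t) {a b : L[X]} (hb : b ≠ 0)
    (hab : IsCoprime a b)
    (h : ∀ q : L[X], q.Monic → Irreducible q → IsRegularAt t q (aeval t a / aeval t b)) :
    IsUnit b := by
  by_contra hu
  obtain ⟨q, hm, hq, hqb⟩ := exists_monic_irreducible_factor b hu
  obtain ⟨c, d, hd, he⟩ := h q hm hq
  rw [div_eq_div_iff (aeval_ne_zero ht hb) (aeval_ne_zero_of_not_dvd ht hd), ← map_mul,
    ← map_mul, aeval_inj ht] at he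
  have had : q ∣ a * d := he ▸ hqb.mul_left c
  have ha : q ∣ a := (hq.prime.dvd_or_dvd had).resolve_right hd
  exact hq.not_isUnit (hab.isUnit_of_dvd' ha hqb)

end Poles

section PartialFractions

variable {L K : Type*} [Field L] [Field K] [Algebra L K] {t : K}

/-- The possible denominators in an irreducible partial fraction decomposition. -/
abbrev Place (L : Type*) [Field L] : Type _ :=
  {q : L[X] // q.Monic ∧ Irreducible q}

theorem isCoprime_of_ne {p q : Place L} (h : p ≠ q) : IsCoprime p.1 q.1 :=
  (p.2.2.coprime_iff_not_dvd).2 fun hdvd => h <| Subtype.ext <|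
    eq_of_monic_of_associated p.2.1 q.2.1 (p.2.2.associated_of_dvd q.2.2 hdvd)

/-- The canonical `L`-basis of `L(t)` as a family. The index `⟨q, j, k⟩` stands for
`t ^ k / q ^ (j + 1)`: the pole order is shifted by one. -/
noncomputable def canonicalFamily (L : Type*) {K : Type*} [Field L] [Field K] [Algebra L K]
    (t : K) : (ℕ ⊕ Σ q : Place L, ℕ × Fin q.1.natDegree) → K :=
  Sum.elim (fun k => t ^ k) fun i => t ^ (i.2.2 : ℕ) / aeval t i.1.1 ^ (i.2.1 + 1)

theorem aeval_mem_span_canonicalFamily (t : K) (p : L[X]) :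
    aeval t p ∈ Submodule.span L (Set.range (canonicalFamily L t)) := by
  rw [aeval_eq_sum_range]
  exact Submodule.sum_mem _ fun k _ =>
    Submodule.smul_mem _ _ (Submodule.subset_span ⟨Sum.inl k, rfl⟩)

theorem aeval_div_pow_mem_span_canonicalFamily (t : K) (q : Place L) {r : L[X]}
    (hr : r.degree < q.1.degree) (j : ℕ) :
    aeval t r / aeval t q.1 ^ (j + 1) ∈ Submodule.span L (Set.range (canonicalFamily L t)) := by
  rcases eq_or_ne r 0 with rfl | hr0
  · rw [map_zero, zero_div]; exact zero_mem _
  rw [aeval_eq_sum_range' (natDegree_lt_natDegree hr0 hr), Finset.sum_div, Finset.sum_range]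
  refine Submodule.sum_mem _ fun k _ => ?_
  rw [smul_div_assoc]
  exact Submodule.smul_mem _ _ (Submodule.subset_span ⟨Sum.inr ⟨q, j, k⟩, rfl⟩)

theorem aeval_div_mem_span_canonicalFamily (ht : Transcendental L t) (a b : L[X]) :
    aeval t a / aeval t b ∈ Submodule.span L (Set.range (canonicalFamily L t)) := by
  classical
  rcases eq_or_ne b 0 with rfl | hb
  · rw [map_zero, div_zero]; exact zero_mem _
  let _ : Algebra L[X] K := (aeval t).toAlgebra
  let m := UniqueFactorizationMonoid.normalizedFactors b
  have hm {q : L[X]} (hq : q ∈ m.toFinset) : q.Monic ∧ Irreducible q :=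
    ((Polynomial.mem_normalizedFactors_iff hb).1 (Multiset.mem_toFinset.1 hq)).symm.imp_left
      And.left
  obtain ⟨p, r, hr, heq⟩ := mul_prod_pow_inverse_eq_quo_add_sum_rem_mul_pow_inverse (K := K)
    (s := m.toFinset) (g := id) (gi := fun q => (aeval t q)⁻¹) (C b.leadingCoeff⁻¹ * a)
    (fun q hq => (hm hq).1)
    (fun p hp q hq hpq => isCoprime_of_ne (p := ⟨p, hm hp⟩) (q := ⟨q, hm hq⟩)
      fun h => hpq (congrArg Subtype.val h))
    (fun q => m.count q) (fun q hq => inv_mul_cancel₀ (aeval_ne_zero ht (hm hq).1.ne_zero))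
  have hfactor : aeval t a / aeval t b =
      aeval t (C b.leadingCoeff⁻¹ * a) * ∏ q ∈ m.toFinset, (aeval t q)⁻¹ ^ m.count q := by
    conv_lhs => rw [← leadingCoeff_mul_prod_normalizedFactors b]
    rw [Finset.prod_multiset_count, map_mul, map_mul, map_prod, aeval_C, aeval_C, map_inv₀]
    simp only [map_pow, inv_pow, Finset.prod_inv_distrib]
    rw [div_eq_mul_inv, mul_inv]
    ring
  refine hfactor ▸ heq ▸ add_mem (aeval_mem_span_canonicalFamily t p) <|
    Submodule.sum_mem _ fun q hq => Submodule.sum_mem _ fun j _ => ?_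
  rw [inv_pow, ← div_eq_mul_inv]
  exact aeval_div_pow_mem_span_canonicalFamily t ⟨q, hm hq⟩ (hr q hq j) j

variable (l : (ℕ ⊕ Σ q : Place L, ℕ × Fin q.1.natDegree) →₀ L)

/-- The polynomial part of the linear combination of `canonicalFamily L t` with coefficients
`l`. -/
noncomputable def polynomialPart : L[X] :=
  ∑ k ∈ l.support.toLeft, monomial k (l (Sum.inl k))

/-- The numerator over `q ^ (j + 1)` in the linear combination of `canonicalFamily L t` with
coefficients `l`. -/
noncomputable def numeratorAt (q : Place L) (j : ℕ) : L[X] :=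
  ∑ k : Fin q.1.natDegree, monomial k (l (Sum.inr ⟨q, j, k⟩))

theorem coeff_polynomialPart (k : ℕ) : (polynomialPart l).coeff k = l (Sum.inl k) := by
  simp only [polynomialPart, finsetSum_coeff, coeff_monomial, Finset.sum_ite_eq',
    Finset.mem_toLeft, Finsupp.mem_support_iff, ite_eq_left_iff, not_not]
  exact Eq.symm

theorem coeff_numeratorAt (q : Place L) (j : ℕ) (k : Fin q.1.natDegree) :
    (numeratorAt l q j).coeff k = l (Sum.inr ⟨q, j, k⟩) := by
  simp only [numeratorAt, finsetSum_coeff, coeff_monomial, Fin.val_inj, Finset.sum_ite_eq',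
    Finset.mem_univ, if_true]

theorem degree_numeratorAt_lt (q : Place L) (j : ℕ) : (numeratorAt l q j).degree < q.1.degree := by
  rw [degree_eq_natDegree q.2.1.ne_zero]
  refine (degree_sum_le _ _).trans_lt ((Finset.sup_lt_iff (WithBot.bot_lt_coe _)).2 fun k _ => ?_)
  exact (degree_monomial_le _ _).trans_lt (by exact_mod_cast k.2)

theorem linearCombination_canonicalFamily (t : K) {s : Finset (Place L)} {N : ℕ}
    (hs : l.support.toRight ⊆ s.sigma fun _ => Finset.range N ×ˢ Finset.univ) :
    Finsupp.linearCombination L (canonicalFamily L t) l = aeval t (polynomialPart l) +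
      ∑ q ∈ s, ∑ j : Fin N, aeval t (numeratorAt l q j) * (aeval t q.1)⁻¹ ^ ((j : ℕ) + 1) := by
  rw [Finsupp.linearCombination_apply, Finsupp.sum,
    ← Finset.toLeft_disjSum_toRight (u := l.support), Finset.sum_disjSum,
    Finset.sum_subset hs fun i _ hi => by
      rw [Finset.mem_toRight, Finsupp.notMem_support_iff] at hi; rw [hi, zero_smul],
    Finset.sum_sigma]
  congr 1
  · simp only [polynomialPart, map_sum, aeval_monomial, ← Algebra.smul_def, canonicalFamily,
      Sum.elim_inl]
  · simp only [Finset.sum_product, Finset.sum_range, numeratorAt, map_sum, Finset.sum_mul,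
      aeval_monomial, ← Algebra.smul_def, canonicalFamily, Sum.elim_inr, div_eq_mul_inv, inv_pow,
      smul_mul_assoc]

theorem linearIndependent_canonicalFamily (ht : Transcendental L t) :
    LinearIndependent L (canonicalFamily L t) := by
  classical
  let _ : Algebra L[X] K := (aeval t).toAlgebra
  have : FaithfulSMul L[X] K :=
    (faithfulSMul_iff_algebraMap_injective _ _).2 (transcendental_iff_injective.1 ht)
  refine linearIndependent_iff.2 fun l hl => ?_
  let s := l.support.toRight.image Sigma.fst
  let N := (l.support.toRight.sup fun i => i.2.1) + 1
  have hs : l.support.toRight ⊆ s.sigma fun _ => Finset.range N ×ˢ Finset.univ := fun i hi => by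
    have hle : i.2.1 ≤ l.support.toRight.sup fun i => i.2.1 :=
      Finset.le_sup (f := fun i : Σ q : Place L, ℕ × Fin q.1.natDegree => i.2.1) hi
    simp only [Finset.mem_sigma, Finset.mem_product, Finset.mem_range, Finset.mem_univ, and_true]
    exact ⟨Finset.mem_image_of_mem Sigma.fst hi, Nat.lt_succ_of_le hle⟩
  rw [linearCombination_canonicalFamily l t hs] at hl
  obtain ⟨hpoly, hnum⟩ := quo_add_sum_rem_mul_pow_inverse_unique (K := K) (s := s)
    (g := fun q => q.1) (gi := fun q => (aeval t q.1)⁻¹) (n := fun _ => N)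
    (q₁ := polynomialPart l) (q₂ := 0) (r₁ := fun q j => numeratorAt l q j) (r₂ := fun _ _ => 0)
    (fun q _ => q.2.1) (fun p _ q _ => isCoprime_of_ne)
    (fun q _ => inv_mul_cancel₀ (aeval_ne_zero ht q.2.1.ne_zero))
    (fun q _ j => degree_numeratorAt_lt l q j)
    (fun q _ _ => by simpa [bot_lt_iff_ne_bot] using q.2.1.ne_zero)
    (hl.trans (by simp only [map_zero, zero_mul, Finset.sum_const_zero, add_zero]))
  ext (k | ⟨q, j, k⟩)
  · rw [← coeff_polynomialPart, hpoly, coeff_zero, Finsupp.zero_apply]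
  · by_contra hne
    have hmem := hs (Finset.mem_toRight.2 (Finsupp.mem_support_iff.2 hne))
    simp only [Finset.mem_sigma, Finset.mem_product, Finset.mem_range] at hmem
    rw [← coeff_numeratorAt, congrFun (hnum q hmem.1) ⟨j, hmem.2.1⟩] at hne
    exact hne (coeff_zero _)

end PartialFractions

section ProperFractions

variable {F₀ : Type u} {K : Type v} [Field F₀] [Field K] [Algebra F₀ K]
  {L : IntermediateField F₀ K} {t : K}

theorem div_mem_properFractions (ht : Transcendental L t) {a b : L[X]} (h : a.degree < b.degree) :
    aeval t a / aeval t b ∈ properFractions L t := by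
  have hb : b ≠ 0 := ne_zero_of_degree_gt h
  obtain ⟨a', b', g, hab, ha, hb'⟩ :=
    UniqueFactorizationMonoid.exists_reduced_factors' a b hb
  subst ha hb'
  rw [degree_mul, degree_mul] at h
  obtain ⟨hg, hb'⟩ := mul_ne_zero_iff.1 hb
  have hc : b'.leadingCoeff⁻¹ ≠ 0 := inv_ne_zero (leadingCoeff_ne_zero.2 hb')
  refine ⟨a' * C b'.leadingCoeff⁻¹, b' * C b'.leadingCoeff⁻¹, monic_mul_leadingCoeff_inv hb',
    (isCoprime_mul_unit_right (isUnit_C.2 hc.isUnit) _ _).2 hab.isCoprime, ?_, ?_⟩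
  · rw [degree_mul_C hc, degree_mul_C hc]
    exact lt_of_add_lt_add_left h
  · rw [map_mul, map_mul, map_mul, map_mul, mul_div_mul_left _ _ (aeval_ne_zero ht hg),
      mul_div_mul_right _ _ (aeval_ne_zero ht (C_ne_zero.2 hc))]

/-- The `L`-subspace of `L(t)` formed by the proper fractions. -/
def properSubmodule (ht : Transcendental L t) : Submodule L K where
  carrier := properFractions L t
  zero_mem' := ⟨0, 1, monic_one, isCoprime_one_right, by simp, by simp⟩
  add_mem' := by
    rintro _ _ ⟨a, b, hb, -, hab, rfl⟩ ⟨c, d, hd, -, hcd, rfl⟩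
    rw [div_add_div _ _ (aeval_ne_zero ht hb.ne_zero) (aeval_ne_zero ht hd.ne_zero), ← map_mul,
      ← map_mul, ← map_mul, ← map_add]
    refine div_mem_properFractions ht ((degree_add_le _ _).trans_lt (max_lt ?_ ?_))
    · rw [degree_mul, degree_mul]
      exact WithBot.add_lt_add_right (degree_ne_bot.2 hd.ne_zero) hab
    · rw [degree_mul, degree_mul]
      exact WithBot.add_lt_add_left (degree_ne_bot.2 hb.ne_zero) hcd
  smul_mem' := by
    rintro c _ ⟨a, b, -, -, hab, rfl⟩
    rw [← smul_div_assoc, ← map_smul]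
    exact div_mem_properFractions ht ((degree_smul_le c a).trans_lt hab)

theorem eq_zero_of_aeval_mem_properFractions (ht : Transcendental L t) {p : L[X]}
    (hp : aeval t p ∈ properFractions L t) : p = 0 := by
  obtain ⟨a, b, hb, -, hab, h⟩ := hp
  rw [eq_div_iff (aeval_ne_zero ht hb.ne_zero), ← map_mul, aeval_inj ht] at h
  by_contra hp0
  rw [← h, mul_comm] at hab
  exact (degree_le_mul_left b hp0).not_gt hab

theorem exists_aeval_add_proper (ht : Transcendental L t) (a b : L[X]) :
    ∃ p : L[X], ∃ g ∈ properFractions L t, aeval t a / aeval t b = aeval t p + g := by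
  rcases eq_or_ne b 0 with rfl | hb
  · exact ⟨0, 0, (properSubmodule ht).zero_mem, by simp only [map_zero, div_zero, add_zero]⟩
  · refine ⟨a / b, aeval t (a % b) / aeval t b,
      div_mem_properFractions ht (EuclideanDomain.mod_lt a hb), ?_⟩
    rw [add_div' _ _ _ (aeval_ne_zero ht hb), ← map_mul, ← map_add, mul_comm,
      EuclideanDomain.div_add_mod]

variable {σ : RingAut K} {s : RingAut L} {β : L}

theorem IsShift.map_mem_properFractions (h : IsShift s β σ t) (ht : Transcendental L t) {f : K}
    (hf : f ∈ properFractions L t) : σ f ∈ properFractions L t := by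
  obtain ⟨a, b, -, -, hab, rfl⟩ := hf
  rw [map_div₀, h.map_aeval, h.map_aeval]
  exact div_mem_properFractions ht (by rwa [degree_twist, degree_twist])

theorem exists_monic_of_mem_closure {S : Set K} (hS : S ⊆ monicIrreducibles L t) {d : K}
    (hd : d ∈ Submonoid.closure S) :
    ∃ D : L[X], D.Monic ∧ d = aeval t D ∧
      ∀ q : L[X], q.Monic → Irreducible q → q ∣ D → aeval t q ∈ S := by
  induction hd using Submonoid.closure_induction with
  | mem x hx =>
    obtain ⟨p, hp, hpi, rfl⟩ := hS hx
    refine ⟨p, hp, rfl, fun q hq hqi hd => ?_⟩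
    rwa [eq_of_monic_of_associated hq hp (hqi.associated_of_dvd hpi hd)]
  | one =>
    exact ⟨1, monic_one, (map_one _).symm, fun q _ hqi hd => absurd (isUnit_of_dvd_one hd) hqi.1⟩
  | mul x y _ _ hx hy =>
    obtain ⟨D, hD, rfl, hDS⟩ := hx
    obtain ⟨E, hE, rfl, hES⟩ := hy
    exact ⟨D * E, hD.mul hE, (map_mul _ _ _).symm, fun q hq hqi hd =>
      (hqi.prime.dvd_or_dvd hd).elim (hDS q hq hqi) (hES q hq hqi)⟩

theorem mem_of_not_isRegularAt {S : Set K} (hS : S ⊆ monicIrreducibles L t)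
    {f : K} (hf : f ∈ properComplement L t S) {q : L[X]} (hm : q.Monic)
    (hq : Irreducible q) (h : ¬ IsRegularAt t q f) : aeval t q ∈ S := by
  obtain ⟨-, a, d, hd, rfl⟩ := hf
  obtain ⟨D, -, rfl, hS⟩ := exists_monic_of_mem_closure hS hd
  exact hS q hm hq (by_contra fun hqD => h ⟨a, D, hqD, rfl⟩)

theorem sigmaEquiv_zpow_twist (h : IsShift s β σ t) (q : L[X]) (ℓ : ℤ) :
    SigmaEquiv σ L (aeval t ((twist s β ^ ℓ) q)) (aeval t q) :=
  ⟨1, one_ne_zero, ℓ, by rw [h.zpow_aeval, IntermediateField.coe_one, one_mul]⟩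

theorem zpow_twist_eq_of_mem_representatives (ht : Transcendental L t) (h : IsShift s β σ t)
    {S : Set K} (hS : IsRepresentatives σ L t S) {q : L[X]} (hm : q.Monic) (hq : Irreducible q)
    {k ℓ : ℤ} (hk : aeval t ((twist s β ^ k) q) ∈ S) (hℓ : aeval t ((twist s β ^ ℓ) q) ∈ S) :
    (twist s β ^ k) q = (twist s β ^ ℓ) q :=
  (aeval_inj ht).1 <| (hS.2 _ ⟨q, hm, hq, rfl⟩).unique ⟨hk, sigmaEquiv_zpow_twist h q k⟩
    ⟨hℓ, sigmaEquiv_zpow_twist h q ℓ⟩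

theorem eq_zero_of_delta_mem_properComplement (ht : Transcendental L t) (h : IsShift s β σ t)
    (hc : ∀ f : K, σ f = f → ∃ c : L, algebraMap L K c = f) {S : Set K}
    (hS : IsRepresentatives σ L t S) {g : K} (hg : g ∈ properFractions L t)
    (hu : σ g - g ∈ properComplement L t S) : g = 0 := by
  obtain ⟨a, b, hb, hab, hdeg, hgab⟩ := hg
  have hreg (q : L[X]) (hm : q.Monic) (hq : Irreducible q) : IsRegularAt t q g := by
    by_contra hpole
    obtain ⟨k, ℓ, hne, hk, hℓ⟩ := h.exists_two_poles_delta ht hc hm hq a hb.ne_zero hgab hpole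
    have mem_of_pole (i : ℤ) (hi : ¬ IsRegularAt t ((twist s β ^ i) q) (σ g - g)) :
        aeval t ((twist s β ^ i) q) ∈ S :=
      mem_of_not_isRegularAt hS.1 hu (monic_zpow_twist s β hm i) (irreducible_zpow_twist s β hq i)
        hi
    exact hne (zpow_twist_eq_of_mem_representatives ht h hS hm hq (mem_of_pole k hk)
      (mem_of_pole ℓ hℓ))
  obtain rfl : b = 1 :=
    hb.eq_one_of_isUnit (isUnit_of_isRegularAt ht hb.ne_zero hab (hgab ▸ hreg))
  rw [degree_one, Nat.WithBot.lt_zero_iff, degree_eq_bot] at hdeg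
  rw [hgab, hdeg, map_zero, zero_div]

end ProperFractions

section Coordinates

variable {C : Type u} {V : Type v} [Field C] [AddCommGroup V] [Module C V] {B : Set V} {θ f g : V}
  {c d : C}

theorem HasCoord.zero : HasCoord C B θ 0 0 := ⟨0, zero_mem _, map_zero _, rfl⟩

theorem HasCoord.add (hf : HasCoord C B θ f c) (hg : HasCoord C B θ g d) :
    HasCoord C B θ (f + g) (c + d) := by
  obtain ⟨l, hl, rfl, rfl⟩ := hf
  obtain ⟨m, hm, rfl, rfl⟩ := hg
  exact ⟨l + m, add_mem hl hm, map_add _ _ _, rfl⟩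

theorem HasCoord.smul (a : C) (hf : HasCoord C B θ f c) : HasCoord C B θ (a • f) (a * c) := by
  obtain ⟨l, hl, rfl, rfl⟩ := hf
  exact ⟨a • l, Submodule.smul_mem _ _ hl, map_smul _ _ _, rfl⟩

theorem HasCoord.unique (hB : LinearIndepOn C id B) (hf : HasCoord C B θ f c)
    (hg : HasCoord C B θ f d) : c = d := by
  obtain ⟨l, hl, rfl, rfl⟩ := hf
  obtain ⟨m, hm, h, rfl⟩ := hg
  have hlm := linearIndepOn_iff.1 hB (l - m) (sub_mem hl hm) (by rw [map_sub, h, sub_self])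
  rw [sub_eq_zero.1 hlm]

theorem exists_hasCoord (θ : V) (hf : f ∈ Submodule.span C B) : ∃ c, HasCoord C B θ f c := by
  rw [← Set.image_id B, Finsupp.mem_span_image_iff_linearCombination] at hf
  obtain ⟨l, hl, rfl⟩ := hf
  exact ⟨l θ, l, hl, rfl, rfl⟩

/-- The subspace `ker θ^*` of the vectors whose `θ`-coordinate in the basis `B` vanishes. -/
def coordKer (C : Type u) {V : Type v} [Field C] [AddCommGroup V] [Module C V] (B : Set V)
    (θ : V) : Submodule C V where
  carrier := {f | HasCoord C B θ f 0}
  zero_mem' := HasCoord.zero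
  add_mem' hf hg := add_zero (0 : C) ▸ HasCoord.add hf hg
  smul_mem' c _ hf := mul_zero c ▸ HasCoord.smul c hf

end Coordinates

section Reduction

variable {C : Type u} {V : Type v} [Field C] [AddCommGroup V] [Module C V] {U : Set V}
  {φ : V →ₗ[C] V}

theorem IsCompleteReduction.apply_eq_zero_iff (h : IsCompleteReduction U φ) {f : V} :
    φ f = 0 ↔ f ∈ U := by
  rw [← h.2, SetLike.mem_coe, LinearMap.mem_ker]

theorem IsCompleteReduction.apply_of_mem_range (h : IsCompleteReduction U φ) {f : V}
    (hf : f ∈ LinearMap.range φ) : φ f = f := by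
  obtain ⟨g, rfl⟩ := hf
  have hfix := h.apply_eq_zero_iff.2 (h.1 g)
  rwa [map_sub, sub_eq_zero, eq_comm] at hfix

theorem exists_isCompleteReduction {D W : Submodule C V} (h : IsCompl D W) :
    ∃ φ : V →ₗ[C] V, IsCompleteReduction (D : Set V) φ ∧ LinearMap.range φ = W := by
  refine ⟨W.projection D h.symm, ⟨fun f => ?_, ?_⟩, ?_⟩
  · rw [SetLike.mem_coe, ← Submodule.projection_apply_eq_zero_iff h.symm, map_sub, sub_eq_zero]
    exact (Submodule.projection_apply_left h.symm ⟨_, Submodule.projection_apply_mem h.symm f⟩).symm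
  · rw [Submodule.ker_projection]
  · rw [Submodule.range_projection]

theorem exists_isCompleteReduction_comap {V' : Type w} [AddCommGroup V'] [Module C V']
    {i : V' →ₗ[C] V} (hi : Function.Injective i) {D W : Submodule C V} (hdisj : Disjoint D W)
    (hsup : D ⊔ W = LinearMap.range i) :
    ∃ φ : V' →ₗ[C] V', IsCompleteReduction (D.comap i : Set V') φ ∧
      LinearMap.range φ = W.comap i := by
  refine exists_isCompleteReduction ⟨?_, codisjoint_iff.2 (eq_top_iff.2 fun z _ => ?_)⟩
  · rw [Submodule.disjoint_def] at hdisj ⊢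
    exact fun x hD hW => hi ((hdisj _ hD hW).trans (map_zero i).symm)
  · obtain ⟨d, hd, w, hw, hdw⟩ := Submodule.mem_sup.1 (hsup.ge (LinearMap.mem_range_self i z))
    obtain ⟨d, rfl⟩ := hsup.le (Submodule.mem_sup_left hd)
    obtain ⟨w, rfl⟩ := hsup.le (Submodule.mem_sup_right hw)
    exact Submodule.mem_sup.2 ⟨d, hd, w, hw, hi (by rw [map_add, hdw])⟩

theorem IsCompleteReduction.conj {V' : Type w} [AddCommGroup V'] [Module C V']
    (h : IsCompleteReduction U φ) (e : V ≃ₗ[C] V') :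
    IsCompleteReduction (e.symm ⁻¹' U) (e.conj φ) := by
  refine ⟨fun f => ?_, Set.ext fun f => ?_⟩
  · rw [Set.mem_preimage, map_sub, LinearEquiv.conj_apply_apply, e.symm_apply_apply]
    exact h.1 _
  · rw [SetLike.mem_coe, LinearMap.mem_ker, LinearEquiv.conj_apply_apply,
      LinearEquiv.map_eq_zero_iff, h.apply_eq_zero_iff, Set.mem_preimage]

end Reduction

section Polynomials

/-- `W` complements the span of `Δ(L)` and the multiples `c β` of `β` by constants `c`, and these
multiples are independent of `Δ(L)`. -/
structure IsDeltaComplement {L : Type*} [CommRing L] (s : RingAut L) (β : L) (W : AddSubgroup L) :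
    Prop where
  exists_split : ∀ a : L, ∃ w ∈ W, ∃ b c : L, s c = c ∧ a = w + (s b - b) + c * β
  eq_zero : ∀ w ∈ W, ∀ b c : L, s c = c → w = s b - b + c * β → c = 0 ∧ w = 0

theorem IsDeltaComplement.eq_zero_of_coeff_mem {L : Type*} [CommRing L] [IsDomain L] [CharZero L]
    {s : RingAut L} {β : L} {W : AddSubgroup L} (hW : IsDeltaComplement s β W) {g : L[X]}
    (hg : ∀ k, (twist s β g - g).coeff k ∈ W) : twist s β g - g = 0 := by
  have hlead : s g.leadingCoeff - g.leadingCoeff = 0 := by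
    have hmem := hg g.natDegree
    rw [coeff_sub, coeff_twist_of_natDegree_le s β le_rfl] at hmem
    exact (hW.eq_zero _ hmem _ 0 (map_zero s) (by rw [zero_mul, add_zero])).2
  cases hd : g.natDegree with
  | zero =>
    rw [leadingCoeff, hd] at hlead
    rw [eq_C_of_natDegree_le_zero (p := twist s β g - g), coeff_sub,
      coeff_twist_of_natDegree_le s β hd.le, hlead, C_0]
    exact (natDegree_sub_le _ _).trans (by rw [natDegree_twist, hd, max_self])
  | succ n =>
    have hconst := sub_eq_zero.1 hlead
    rw [leadingCoeff, hd] at hconst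
    have hzero := (hW.eq_zero _ (hg n) (g.coeff n) ((n + 1) * g.coeff (n + 1))
      (by rw [map_mul, map_add, map_natCast, map_one, hconst])
      (by rw [coeff_sub, coeff_twist s β hd.le, hconst]; ring)).1
    have hlead0 : g.leadingCoeff = 0 := by
      rw [leadingCoeff, hd]
      exact (mul_eq_zero.1 hzero).resolve_left (Nat.cast_add_one_ne_zero n)
    rw [leadingCoeff_eq_zero.1 hlead0, map_zero, sub_zero]

variable {L : Type*} [Field L] [CharZero L] {s : RingAut L} {β : L}

/-- The leading coefficient of `Δ(t ^ (d + 1))` is `(d + 1) β`, so `c β t ^ d` is summable up to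
terms of lower degree. -/
theorem degree_sub_delta_sub_monomial_lt {p : L[X]} {d : ℕ} (hp : p.natDegree ≤ d) {w b c : L}
    (hc : s c = c) (h : p.coeff d = w + (s b - b) + c * β) :
    (p - (twist s β (monomial (d + 1) (c / (d + 1)) + monomial d b) -
      (monomial (d + 1) (c / (d + 1)) + monomial d b)) - monomial d w).degree < d := by
  have hd : (d : L) + 1 ≠ 0 := Nat.cast_add_one_ne_zero d
  have hconst : s (c / (d + 1)) = c / (d + 1) := by
    rw [map_div₀, hc, map_add, map_natCast, map_one]
  have hg : (monomial (d + 1) (c / (d + 1)) + monomial d b).natDegree ≤ d + 1 :=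
    natDegree_add_le_of_degree_le (natDegree_monomial_le _)
      ((natDegree_monomial_le _).trans d.le_succ)
  rw [degree_lt_iff_coeff_zero]
  intro n hn
  rcases hn.eq_or_lt with rfl | hn
  · simp only [coeff_sub, coeff_twist s β hg, coeff_add, coeff_monomial, Nat.succ_ne_self,
      Nat.ne_add_one, if_true, if_false, zero_add, add_zero, hconst, h]
    field_simp
    ring
  · rw [coeff_sub, coeff_sub, coeff_sub, coeff_eq_zero_of_natDegree_lt (hp.trans_lt hn),
      coeff_twist_of_natDegree_le s β (hg.trans hn), coeff_monomial_of_ne _ hn.ne',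
      coeff_add, coeff_monomial_of_ne _ hn.ne', coeff_monomial]
    split_ifs
    · rw [add_zero, hconst, sub_self, sub_zero, sub_zero]
    · rw [add_zero, map_zero, sub_zero, sub_zero, sub_zero]

theorem IsDeltaComplement.exists_polynomial_split {W : AddSubgroup L}
    (hW : IsDeltaComplement s β W) (p : L[X]) :
    ∃ g v : L[X], (∀ k, v.coeff k ∈ W) ∧ p = twist s β g - g + v := by
  obtain ⟨d, hd⟩ : ∃ d : ℕ, p.degree < d := ⟨p.natDegree + 1,
    degree_le_natDegree.trans_lt (Nat.cast_lt.2 p.natDegree.lt_succ_self)⟩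
  induction d generalizing p with
  | zero =>
    rw [Nat.cast_zero, Nat.WithBot.lt_zero_iff, degree_eq_bot] at hd
    exact ⟨0, 0, fun _ => W.zero_mem, by rw [hd, map_zero, sub_zero, add_zero]⟩
  | succ d ih =>
    obtain ⟨w, hw, b, c, hc, hcoeff⟩ := hW.exists_split (p.coeff d)
    obtain ⟨g, v, hv, hg⟩ := ih _ (degree_sub_delta_sub_monomial_lt
      (natDegree_le_iff_degree_le.2 (Order.le_of_lt_succ hd)) hc hcoeff)
    refine ⟨monomial (d + 1) (c / (d + 1)) + monomial d b + g, v + monomial d w, fun k => ?_, ?_⟩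
    · rw [coeff_add, coeff_monomial]
      split_ifs
      · exact add_mem (hv k) hw
      · exact add_mem (hv k) W.zero_mem
    · rw [map_add]
      linear_combination hg

end Polynomials

section Step

variable {F₀ : Type u} {K : Type v} [Field F₀] [Field K] [Algebra F₀ K]
  {L : IntermediateField F₀ K} {t : K}

theorem range_canonicalFamily (L : IntermediateField F₀ K) (t : K) :
    Set.range (canonicalFamily L t) = canonicalStep L t := by
  ext x
  constructor
  · rintro ⟨k | ⟨⟨q, hm, hq⟩, j, k⟩, rfl⟩
    · exact Or.inl ⟨k, rfl⟩
    · exact Or.inr ⟨q, hm, hq, k, j + 1, k.2, Nat.le_add_left 1 j, rfl⟩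
  · rintro (⟨k, rfl⟩ | ⟨q, hm, hq, k, j, hk, hj, rfl⟩)
    · exact ⟨Sum.inl k, rfl⟩
    · obtain ⟨j, rfl⟩ := Nat.exists_eq_add_of_le' hj
      exact ⟨Sum.inr ⟨⟨q, hm, hq⟩, j, k, hk⟩, rfl⟩

/-- The subfield `L(t)` of `K`, as an extension of the ground field of `L`. -/
def simpleAdjoin (L : IntermediateField F₀ K) (t : K) : IntermediateField F₀ K :=
  (IntermediateField.adjoin L {t}).restrictScalars F₀

theorem mem_simpleAdjoin_iff {f : K} :
    f ∈ simpleAdjoin L t ↔ ∃ a b : L[X], f = aeval t a / aeval t b :=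
  IntermediateField.mem_adjoin_simple_iff L f

theorem aeval_mem_simpleAdjoin (p : L[X]) : aeval t p ∈ simpleAdjoin L t :=
  mem_simpleAdjoin_iff.2 ⟨p, 1, by rw [map_one, div_one]⟩

theorem properFractions_subset_simpleAdjoin : properFractions L t ⊆ simpleAdjoin L t := by
  rintro _ ⟨a, b, -, -, -, rfl⟩
  exact mem_simpleAdjoin_iff.2 ⟨a, b, rfl⟩

variable {σ : RingAut K} {s : RingAut L} {β : L}

theorem IsShift.zpow_mem_simpleAdjoin (h : IsShift s β σ t) (ℓ : ℤ) {f : K}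
    (hf : f ∈ simpleAdjoin L t) : (σ ^ ℓ) f ∈ simpleAdjoin L t := by
  obtain ⟨a, b, rfl⟩ := mem_simpleAdjoin_iff.1 hf
  exact mem_simpleAdjoin_iff.2 ⟨_, _, by rw [map_div₀, h.zpow_aeval, h.zpow_aeval]⟩

variable {C : Type w} [Field C] [Algebra C F₀] [Algebra C K] [IsScalarTower C F₀ K]

/-- `Δ` as a linear map over a field of constants. -/
def deltaMap (hC : ∀ c : C, σ (algebraMap C K c) = algebraMap C K c) : K →ₗ[C] K where
  toFun f := σ f - f
  map_add' f g := by rw [map_add, add_sub_add_comm]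
  map_smul' c f := by rw [Algebra.smul_def, map_mul, hC, ← mul_sub, ← Algebra.smul_def]; rfl

/-- The inclusion of an intermediate field as a linear map over a field of constants. -/
def inclusion (C : Type w) [Field C] [Algebra C F₀] [Algebra C K] [IsScalarTower C F₀ K]
    (L : IntermediateField F₀ K) : L →ₗ[C] K :=
  L.val.toLinearMap.restrictScalars C

/-- The summable space `Δ(L)` as a subspace of `K`. -/
def deltaSubmodule (hC : ∀ c : C, σ (algebraMap C K c) = algebraMap C K c)
    (L : IntermediateField F₀ K) : Submodule C K :=
  (LinearMap.range (inclusion C L)).map (deltaMap hC)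

/-- The coefficient space `im φ ∩ ker θ^*` of `V_θ`. -/
def reducedKernel (φ : L →ₗ[C] L) (B : Set K) (θ : K) : Submodule C L :=
  LinearMap.range φ ⊓ (coordKer C B θ).comap (inclusion C L)

end Step

section Step

variable {F₀ : Type u} {K : Type v} [Field F₀] [Field K] [Algebra F₀ K]
  {L : IntermediateField F₀ K} {t : K} {σ : RingAut K} {s : RingAut L} {β : L}

theorem mem_summableIn_iff (hs : ∀ c : L, σ (algebraMap L K c) = algebraMap L K (s c)) {f : L} :
    f ∈ summableIn σ L ↔ ∃ b : L, f = s b - b := by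
  refine exists_congr fun b => ?_
  rw [← IntermediateField.algebraMap_apply, ← IntermediateField.algebraMap_apply, hs, ← map_sub,
    (algebraMap L K).injective.eq_iff]

variable {C : Type w} [Field C] [Algebra C F₀] [Algebra C K] [IsScalarTower C F₀ K]

instance isScalarTower_intermediateField : IsScalarTower C L K :=
  IsScalarTower.of_algebraMap_eq fun _ => rfl

theorem mem_range_inclusion {f : K} : f ∈ LinearMap.range (inclusion C L) ↔ f ∈ L :=
  ⟨fun ⟨g, hg⟩ => hg ▸ g.2, fun hf => ⟨⟨f, hf⟩, rfl⟩⟩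

theorem mem_deltaSubmodule {hC : ∀ c : C, σ (algebraMap C K c) = algebraMap C K c} {f : K} :
    f ∈ deltaSubmodule hC L ↔ ∃ g ∈ L, σ g - g = f := by
  rw [deltaSubmodule, Submodule.mem_map]
  simp only [mem_range_inclusion]
  rfl

section Coefficients

variable {φ : L →ₗ[C] L} {B : Set K} {θ : K} {e : C}

theorem exists_split_reducedKernel
    (hs : ∀ c : L, σ (algebraMap L K c) = algebraMap L K (s c))
    (hC : ∀ c : C, σ (algebraMap C K c) = algebraMap C K c)
    (hφ : IsCompleteReduction (summableIn σ L) φ)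
    (hspan : ∀ f ∈ L, f ∈ Submodule.span C B) (he : e ≠ 0)
    (hθ : HasCoord C B θ (φ β : K) e) (a : L) :
    ∃ w ∈ reducedKernel φ B θ, ∃ b c : L, s c = c ∧ a = w + (s b - b) + c * β := by
  have hsc (c : C) : s (algebraMap C L c) = algebraMap C L c :=
    (algebraMap L K).injective ((hs _).symm.trans (hC c))
  obtain ⟨x, hx⟩ := exists_hasCoord θ (hspan _ (φ a).2)
  obtain ⟨b₁, hb₁⟩ := (mem_summableIn_iff hs).1 (hφ.1 a)
  obtain ⟨b₂, hb₂⟩ := (mem_summableIn_iff hs).1 (hφ.1 β)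
  refine ⟨φ (a + -(x / e) • β), ⟨⟨_, rfl⟩, ?_⟩, b₁ - algebraMap C L (x / e) * b₂,
    algebraMap C L (x / e), hsc _, ?_⟩
  · have hcoord := hx.add (hθ.smul (-(x / e)))
    rw [neg_mul, div_mul_cancel₀ x he, add_neg_cancel] at hcoord
    rw [map_add, map_smul]
    exact hcoord
  · rw [map_add, map_smul, map_sub, map_mul, hsc, Algebra.smul_def, map_neg]
    linear_combination hb₁ - algebraMap C L (x / e) * hb₂

theorem eq_zero_of_mem_reducedKernel
    (hs : ∀ c : L, σ (algebraMap L K c) = algebraMap L K (s c))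
    (hc : ∀ f : K, σ f = f → ∃ c : C, algebraMap C K c = f)
    (hφ : IsCompleteReduction (summableIn σ L) φ) (hB : LinearIndepOn C id B) (he : e ≠ 0)
    (hθ : HasCoord C B θ (φ β : K) e) {w : L} (hw : w ∈ reducedKernel φ B θ) {b c : L}
    (hsc : s c = c) (h : w = s b - b + c * β) : c = 0 ∧ w = 0 := by
  obtain ⟨x, hx⟩ := hc (algebraMap L K c) (by rw [hs, hsc])
  obtain rfl : algebraMap C L x = c := Subtype.ext hx
  have hwβ : w = x • φ β := by
    rw [← hφ.apply_of_mem_range hw.1, h, map_add,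
      hφ.apply_eq_zero_iff.2 ((mem_summableIn_iff hs).2 ⟨b, rfl⟩), zero_add, ← Algebra.smul_def,
      map_smul]
  have hcoord : HasCoord C B θ (w : K) (x * e) := hwβ ▸ hθ.smul x
  have hx0 : x = 0 := (mul_eq_zero.1 (hcoord.unique hB hw.2)).resolve_right he
  exact ⟨by rw [hx0, map_zero], by rw [hwβ, hx0, zero_smul]⟩

theorem isDeltaComplement_reducedKernel
    (hs : ∀ c : L, σ (algebraMap L K c) = algebraMap L K (s c))
    (hC : ∀ c : C, σ (algebraMap C K c) = algebraMap C K c)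
    (hc : ∀ f : K, σ f = f → ∃ c : C, algebraMap C K c = f)
    (hφ : IsCompleteReduction (summableIn σ L) φ) (hB : LinearIndepOn C id B)
    (hspan : ∀ f ∈ L, f ∈ Submodule.span C B) (he : e ≠ 0) (hθ : HasCoord C B θ (φ β : K) e) :
    IsDeltaComplement s β (reducedKernel φ B θ).toAddSubgroup where
  exists_split := exists_split_reducedKernel hs hC hφ hspan he hθ
  eq_zero _ hw _ _ := eq_zero_of_mem_reducedKernel hs hc hφ hB he hθ hw

end Coefficients

/-- The space `⨁ₖ W t ^ k` of the polynomials in `t` with coefficients in `W`. -/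
def polynomialsOver (t : K) (W : Submodule C L) : Submodule C K where
  carrier := {f | ∃ p : L[X], (∀ k, p.coeff k ∈ W) ∧ f = aeval t p}
  zero_mem' := ⟨0, fun _ => W.zero_mem, (map_zero _).symm⟩
  add_mem' := by
    rintro _ _ ⟨p, hp, rfl⟩ ⟨q, hq, rfl⟩
    exact ⟨p + q, fun k => coeff_add p q k ▸ W.add_mem (hp k) (hq k), (map_add _ _ _).symm⟩
  smul_mem' := by
    rintro c _ ⟨p, hp, rfl⟩
    exact ⟨c • p, fun k => coeff_smul c p k ▸ W.smul_mem c (hp k),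
      (AlgHom.map_smul_of_tower _ c p).symm⟩

theorem polynomialsOver_reducedKernel (t : K) (φ : L →ₗ[C] L) (B : Set K) (θ : K) :
    (polynomialsOver t (reducedKernel φ B θ) : Set K) = polyComplement L t φ B θ :=
  rfl

/-- The space `U_S` as a subspace of `K`. -/
def properComplementSubmodule (C : Type w) [Field C] [Algebra C F₀] [Algebra C K]
    [IsScalarTower C F₀ K] (ht : Transcendental L t) {S : Set K}
    (hS : S ⊆ monicIrreducibles L t) : Submodule C K where
  carrier := properComplement L t S
  zero_mem' := ⟨(properSubmodule ht).zero_mem, 0, 1, one_mem _, by rw [map_zero, zero_div]⟩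
  add_mem' := by
    rintro _ _ ⟨hf, a, d, hd, rfl⟩ ⟨hg, b, e, he, rfl⟩
    refine ⟨(properSubmodule ht).add_mem hf hg, ?_⟩
    obtain ⟨D, hD, rfl, -⟩ := exists_monic_of_mem_closure hS hd
    obtain ⟨E, hE, rfl, -⟩ := exists_monic_of_mem_closure hS he
    refine ⟨a * E + D * b, _, mul_mem hd he, ?_⟩
    rw [div_add_div _ _ (aeval_ne_zero ht hD.ne_zero) (aeval_ne_zero ht hE.ne_zero), map_add,
      map_mul, map_mul]
  smul_mem' := by
    rintro c _ ⟨hf, a, d, hd, rfl⟩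
    rw [← algebraMap_smul L c (aeval t a / d)]
    exact ⟨(properSubmodule ht).smul_mem (algebraMap C L c) hf, algebraMap C L c • a, d, hd, by
      rw [map_smul, smul_div_assoc]⟩

theorem zpow_div_mem_properComplement (ht : Transcendental L t) (h : IsShift s β σ t) {S : Set K}
    {p : K} (hp : p ∈ S) {q : L[X]} {ℓ : ℤ} {c : L} (hc : c ≠ 0)
    (hpq : p = c * (σ ^ ℓ) (aeval t q)) {a : L[X]} {j : ℕ} (hdeg : a.degree < (q ^ j).degree) :
    (σ ^ ℓ) (aeval t a / aeval t q ^ j) ∈ properComplement L t S := by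
  have hc' : algebraMap L K c ≠ 0 := (_root_.map_ne_zero _).2 hc
  constructor
  · rw [← map_pow, map_div₀, h.zpow_aeval, h.zpow_aeval]
    exact div_mem_properFractions ht (by rwa [degree_zpow_twist, degree_zpow_twist])
  · refine ⟨Polynomial.C (c ^ j) * (twist s β ^ ℓ) a, p ^ j,
      pow_mem (Submonoid.subset_closure hp) j, ?_⟩
    rw [hpq, map_div₀, map_pow, h.zpow_aeval, map_mul, aeval_C, map_pow, mul_pow,
      ← IntermediateField.algebraMap_apply, mul_div_mul_left _ _ (pow_ne_zero j hc')]

theorem sub_zpow_mem {A : Type*} [Ring A] {σ : RingAut A} {D : AddSubgroup A} {f : A}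
    (hD : ∀ ℓ : ℤ, σ ((σ ^ ℓ) f) - (σ ^ ℓ) f ∈ D) (ℓ : ℤ) : f - (σ ^ ℓ) f ∈ D := by
  induction ℓ with
  | zero => rw [zpow_zero, RingAut.one_apply, sub_self]; exact D.zero_mem
  | succ k ih =>
    rw [add_comm, zpow_one_add, RingAut.mul_apply, ← sub_sub_sub_cancel_right _ _ ((σ ^ (k : ℤ)) f)]
    exact sub_mem ih (hD k)
  | pred k ih =>
    have hstep := hD (-(k : ℤ) - 1)
    rw [← RingAut.mul_apply, ← zpow_one_add, add_sub_cancel] at hstep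
    rw [← sub_add_sub_cancel]
    exact add_mem ih hstep

end Step

section Decomposition

variable {F₀ : Type u} {K : Type v} [Field F₀] [Field K] [Algebra F₀ K]
  {L : IntermediateField F₀ K} {t : K} {σ : RingAut K} {s : RingAut L} {β : L}
  {C : Type w} [Field C] [Algebra C F₀] [Algebra C K] [IsScalarTower C F₀ K]
  {W : Submodule C L} {S : Set K}

theorem aeval_mem_delta_sup_polynomialsOver [CharZero L] (h : IsShift s β σ t)
    (hC : ∀ c : C, σ (algebraMap C K c) = algebraMap C K c)
    (hW : IsDeltaComplement s β W.toAddSubgroup) (p : L[X]) :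
    aeval t p ∈ deltaSubmodule hC (simpleAdjoin L t) ⊔ polynomialsOver t W := by
  obtain ⟨g, v, hv, rfl⟩ := hW.exists_polynomial_split p
  rw [map_add, map_sub, ← h.map_aeval]
  exact add_mem
    (Submodule.mem_sup_left (mem_deltaSubmodule.2 ⟨_, aeval_mem_simpleAdjoin g, rfl⟩))
    (Submodule.mem_sup_right ⟨v, hv, rfl⟩)

theorem div_pow_mem_delta_sup_properComplement (ht : Transcendental L t) (h : IsShift s β σ t)
    (hC : ∀ c : C, σ (algebraMap C K c) = algebraMap C K c) (hS : IsRepresentatives σ L t S)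
    {q : L[X]} (hm : q.Monic) (hq : Irreducible q) {a : L[X]} {j : ℕ}
    (hdeg : a.degree < (q ^ j).degree) :
    aeval t a / aeval t q ^ j ∈
      deltaSubmodule hC (simpleAdjoin L t) ⊔ properComplementSubmodule C ht hS.1 := by
  obtain ⟨p, ⟨hp, c, hc, ℓ, hpq⟩, -⟩ := hS.2 _ ⟨q, hm, hq, rfl⟩
  have hmem : aeval t a / aeval t q ^ j ∈ simpleAdjoin L t :=
    mem_simpleAdjoin_iff.2 ⟨a, q ^ j, by rw [map_pow]⟩
  rw [← sub_add_cancel (aeval t a / aeval t q ^ j) ((σ ^ ℓ) (aeval t a / aeval t q ^ j))]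
  exact add_mem
    (Submodule.mem_sup_left (sub_zpow_mem (D := (deltaSubmodule hC _).toAddSubgroup)
      (fun k => mem_deltaSubmodule.2 ⟨_, h.zpow_mem_simpleAdjoin k hmem, rfl⟩) ℓ))
    (Submodule.mem_sup_right (zpow_div_mem_properComplement ht h hp hc hpq hdeg))

theorem simpleAdjoin_le_delta_sup_complement [CharZero L] (ht : Transcendental L t)
    (h : IsShift s β σ t) (hC : ∀ c : C, σ (algebraMap C K c) = algebraMap C K c)
    (hW : IsDeltaComplement s β W.toAddSubgroup) (hS : IsRepresentatives σ L t S) {f : K}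
    (hf : f ∈ simpleAdjoin L t) :
    f ∈ deltaSubmodule hC (simpleAdjoin L t) ⊔
      (properComplementSubmodule C ht hS.1 ⊔ polynomialsOver t W) := by
  obtain ⟨a, b, rfl⟩ := mem_simpleAdjoin_iff.1 hf
  have hspan := aeval_div_mem_span_canonicalFamily ht a b
  generalize aeval t a / aeval t b = f at hspan ⊢
  induction hspan using Submodule.closure_induction with
  | zero => exact zero_mem _
  | add x y _ _ hx hy => exact add_mem hx hy
  | smul_mem c x hx =>
    obtain ⟨k | ⟨⟨q, hm, hq⟩, j, k⟩, rfl⟩ := hx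
    · have hk : c • canonicalFamily L t (Sum.inl k) = aeval t (monomial k c) := by
        rw [aeval_monomial, Algebra.smul_def]; rfl
      rw [hk]
      exact sup_le_sup_left le_sup_right (deltaSubmodule hC (simpleAdjoin L t))
        (aeval_mem_delta_sup_polynomialsOver h hC hW _)
    · have hk : c • canonicalFamily L t (Sum.inr ⟨⟨q, hm, hq⟩, j, k⟩) =
          aeval t (monomial (k : ℕ) c) / aeval t q ^ (j + 1) := by
        rw [aeval_monomial, mul_div_assoc, ← Algebra.smul_def]; rfl
      rw [hk]
      refine sup_le_sup_left le_sup_left (deltaSubmodule hC (simpleAdjoin L t))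
        (div_pow_mem_delta_sup_properComplement ht h hC hS hm hq ?_)
      refine (degree_monomial_le _ _).trans_lt ?_
      rw [degree_eq_natDegree (hm.pow _).ne_zero, hm.natDegree_pow, Nat.cast_lt]
      exact k.2.trans_le (Nat.le_mul_of_pos_left _ j.succ_pos)

theorem disjoint_delta_complement [CharZero L] (ht : Transcendental L t) (h : IsShift s β σ t)
    (hC : ∀ c : C, σ (algebraMap C K c) = algebraMap C K c)
    (hc : ∀ f : K, σ f = f → ∃ c : L, algebraMap L K c = f)
    (hW : IsDeltaComplement s β W.toAddSubgroup) (hS : IsRepresentatives σ L t S) :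
    Disjoint (deltaSubmodule hC (simpleAdjoin L t))
      (properComplementSubmodule C ht hS.1 ⊔ polynomialsOver t W) := by
  rw [Submodule.disjoint_def]
  intro f hf hUV
  obtain ⟨g, hg, rfl⟩ := mem_deltaSubmodule.1 hf
  obtain ⟨u, hu, _, ⟨v, hv, rfl⟩, huv⟩ := Submodule.mem_sup.1 hUV
  obtain ⟨a, b, rfl⟩ := mem_simpleAdjoin_iff.1 hg
  obtain ⟨p, r, hr, hpr⟩ := exists_aeval_add_proper ht a b
  rw [hpr] at huv ⊢
  have hdiff : σ r - r - u ∈ properSubmodule ht :=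
    sub_mem (sub_mem (h.map_mem_properFractions ht hr) hr) hu.1
  have hparts : aeval t (v - (twist s β p - p)) = σ r - r - u := by
    rw [map_add, h.map_aeval] at huv
    rw [map_sub, map_sub]
    linear_combination huv
  have hpoly : v - (twist s β p - p) = 0 :=
    eq_zero_of_aeval_mem_properFractions ht (hparts ▸ hdiff)
  have hproper : σ r - r = u := by
    rw [hpoly, map_zero] at hparts
    exact sub_eq_zero.1 hparts.symm
  have hr0 : r = 0 := eq_zero_of_delta_mem_properComplement ht h hc hS hr (hproper ▸ hu)
  have hp0 : twist s β p - p = 0 :=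
    hW.eq_zero_of_coeff_mem fun k => sub_eq_zero.1 hpoly ▸ hv k
  rw [hr0, add_zero, h.map_aeval, ← map_sub, hp0, map_zero]

theorem exists_isCompleteReduction_simpleAdjoin [CharZero L] (ht : Transcendental L t)
    (h : IsShift s β σ t) (hC : ∀ c : C, σ (algebraMap C K c) = algebraMap C K c)
    (hc : ∀ f : K, σ f = f → ∃ c : L, algebraMap L K c = f)
    (hW : IsDeltaComplement s β W.toAddSubgroup) (hS : IsRepresentatives σ L t S) :
    ∃ φ : simpleAdjoin L t →ₗ[C] simpleAdjoin L t,
      IsCompleteReduction (summableIn σ (simpleAdjoin L t)) φ ∧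
      {x : K | ∃ y ∈ LinearMap.range φ, (y : K) = x} =
        Set.image2 (· + ·) (properComplement L t S) (polynomialsOver t W) := by
  have hUV : properComplementSubmodule C ht hS.1 ⊔ polynomialsOver t W ≤
      LinearMap.range (inclusion C (simpleAdjoin L t)) := by
    refine sup_le (fun f hf => ?_) ?_
    · exact mem_range_inclusion.2 (properFractions_subset_simpleAdjoin hf.1)
    · rintro _ ⟨p, -, rfl⟩
      exact mem_range_inclusion.2 (aeval_mem_simpleAdjoin p)
  have hD : deltaSubmodule hC (simpleAdjoin L t) ≤
      LinearMap.range (inclusion C (simpleAdjoin L t)) := by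
    intro f hf
    obtain ⟨g, hg, rfl⟩ := mem_deltaSubmodule.1 hf
    exact mem_range_inclusion.2 (sub_mem (h.zpow_mem_simpleAdjoin 1 hg) hg)
  obtain ⟨φ, hφ, hrange⟩ := exists_isCompleteReduction_comap
    (i := inclusion C (simpleAdjoin L t)) Subtype.val_injective
    (disjoint_delta_complement ht h hC hc hW hS) ((sup_le hD hUV).antisymm fun f hf =>
      simpleAdjoin_le_delta_sup_complement ht h hC hW hS (mem_range_inclusion.1 hf))
  have hsummable : ((deltaSubmodule hC (simpleAdjoin L t)).comap
      (inclusion C (simpleAdjoin L t)) : Set _) = summableIn σ (simpleAdjoin L t) := by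
    ext f
    exact (mem_deltaSubmodule (L := simpleAdjoin L t)).trans ⟨fun ⟨g, hg, hf⟩ => ⟨⟨g, hg⟩, hf.symm⟩,
      fun ⟨g, hf⟩ => ⟨g, g.2, hf.symm⟩⟩
  refine ⟨φ, hsummable ▸ hφ, ?_⟩
  rw [hrange]
  exact (congrArg SetLike.coe (Submodule.map_comap_eq_self hUV)).trans
    (Submodule.coe_sup _ _)

end Decomposition

section Representatives

variable {F₀ : Type u} {K : Type v} [Field F₀] [Field K] [Algebra F₀ K]
  {L : IntermediateField F₀ K} {σ : RingAut K} {s : RingAut L}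

theorem sigmaEquiv_equivalence (hs : ∀ c : L, σ (algebraMap L K c) = algebraMap L K (s c)) :
    Equivalence (SigmaEquiv σ L) where
  refl p := ⟨1, one_ne_zero, 0, (one_mul p).symm⟩
  symm := by
    rintro p q ⟨c, hc, ℓ, rfl⟩
    have hcoe := apply_zpow_smul (f := algebraMap L K) (g := s) (h := σ) (fun x => (hs x).symm)
    refine ⟨(s ^ (-ℓ)) c⁻¹, (_root_.map_ne_zero _).2 (inv_ne_zero hc), -ℓ, ?_⟩
    have hcancel : ((c⁻¹ : L) : K) * c = 1 := by
      rw [← IntermediateField.coe_mul, inv_mul_cancel₀ hc, IntermediateField.coe_one]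
    calc q = (σ ^ (-ℓ)) ((c⁻¹ : L) * (c * (σ ^ ℓ) q)) := by
          rw [← mul_assoc, hcancel, one_mul, ← RingAut.mul_apply, ← zpow_add, neg_add_cancel,
            zpow_zero, RingAut.one_apply]
      _ = _ := by rw [map_mul]; exact congrArg (· * _) (hcoe (-ℓ) c⁻¹).symm
  trans := by
    rintro p q r ⟨c, hc, k, rfl⟩ ⟨d, hd, ℓ, rfl⟩
    have hcoe := apply_zpow_smul (f := algebraMap L K) (g := s) (h := σ) (fun x => (hs x).symm)
    refine ⟨c * (s ^ k) d, mul_ne_zero hc ((_root_.map_ne_zero _).2 hd), k + ℓ, ?_⟩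
    rw [map_mul, zpow_add, RingAut.mul_apply, IntermediateField.coe_mul, mul_assoc]
    exact congrArg (fun x => (c : K) * (x * _)) (hcoe k d).symm

theorem exists_isRepresentatives
    (hs : ∀ c : L, σ (algebraMap L K c) = algebraMap L K (s c)) (t : K) :
    ∃ S, IsRepresentatives σ L t S := by
  let E : Setoid (monicIrreducibles L t) :=
    (⟨SigmaEquiv σ L, sigmaEquiv_equivalence hs⟩ : Setoid K).comap Subtype.val
  refine ⟨Set.range fun c : Quotient E => (c.out : K), ?_, fun q hq => ?_⟩
  · rintro _ ⟨c, rfl⟩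
    exact c.out.2
  · refine ⟨_, ⟨⟨Quotient.mk E ⟨q, hq⟩, rfl⟩, Quotient.mk_out (s := E) ⟨q, hq⟩⟩, ?_⟩
    rintro _ ⟨⟨c, rfl⟩, hc⟩
    have hclass : c = Quotient.mk E ⟨q, hq⟩ := c.out_eq.symm.trans (Quotient.sound hc)
    rw [hclass]

end Representatives

section Stage

variable {F₀ : Type u} {K : Type v} [Field F₀] [Field K] [Algebra F₀ K] {n : ℕ} {t : Fin n → K}

theorem stage_mono (t : Fin n → K) : Monotone (stage F₀ t) := fun _ _ hij =>
  IntermediateField.adjoin.mono _ _ _ fun _ ⟨k, hk, hx⟩ => ⟨k, hk.trans_le hij, hx⟩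

theorem mem_stage_of_lt (t : Fin n → K) (j : Fin n) {i : ℕ} (h : (j : ℕ) < i) :
    t j ∈ stage F₀ t i :=
  IntermediateField.subset_adjoin _ _ ⟨j, h, rfl⟩

theorem stage_le {i : ℕ} {E : IntermediateField F₀ K} (h : ∀ j : Fin n, (j : ℕ) < i → t j ∈ E) :
    stage F₀ t i ≤ E := by
  refine IntermediateField.adjoin_le_iff.2 ?_
  rintro _ ⟨j, hj, rfl⟩
  exact h j hj

theorem stage_zero (t : Fin n → K) : stage F₀ t 0 = ⊥ :=
  le_bot_iff.1 (stage_le fun _ h => absurd h (Nat.not_lt_zero _))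

theorem stage_succ (t : Fin n → K) (i : Fin n) :
    stage F₀ t (i + 1) = simpleAdjoin (stage F₀ t i) (t i) := by
  rw [simpleAdjoin, stage, stage, IntermediateField.adjoin_adjoin_left]
  congr 1
  ext x
  simp only [Set.mem_ofPred_eq, Set.mem_union, Set.mem_singleton_iff, Nat.lt_succ_iff_lt_or_eq,
    or_and_right, exists_or, Fin.val_inj, exists_eq_left]

theorem map_mem_of_mem_stage {ρ : RingAut K} {i : ℕ} {E : IntermediateField F₀ K}
    (hbase : ∀ x : F₀, ρ (algebraMap F₀ K x) ∈ E)
    (hgen : ∀ j : Fin n, (j : ℕ) < i → ρ (t j) ∈ E) {f : K} (hf : f ∈ stage F₀ t i) :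
    ρ f ∈ E := by
  induction hf using IntermediateField.adjoin_induction with
  | mem x hx => obtain ⟨j, hj, rfl⟩ := hx; exact hgen j hj
  | algebraMap x => exact hbase x
  | add x y _ _ hx hy => rw [map_add]; exact add_mem hx hy
  | inv x _ hx => rw [map_inv₀]; exact inv_mem hx
  | mul x y _ _ hx hy => rw [map_mul]; exact mul_mem hx hy

variable {σ₀ : RingAut F₀} {σ : RingAut K}

theorem IsSigmaTower.map_mem_stage (ht : IsSigmaTower σ₀ σ t) {i : ℕ} {f : K}
    (hf : f ∈ stage F₀ t i) : σ f ∈ stage F₀ t i := by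
  refine map_mem_of_mem_stage (fun x => ?_) (fun j hj => ?_) hf
  · rw [ht.extends_base]; exact IntermediateField.algebraMap_mem _ _
  · rw [← sub_add_cancel (σ (t j)) (t j)]
    exact add_mem (stage_mono t hj.le (ht.delta_mem j)) (mem_stage_of_lt t j hj)

theorem IsSigmaTower.symm_map_mem_stage (ht : IsSigmaTower σ₀ σ t) {i : ℕ} {f : K}
    (hf : f ∈ stage F₀ t i) : σ.symm f ∈ stage F₀ t i := by
  induction i using Nat.strong_induction_on generalizing f with
  | _ i ih =>
    refine map_mem_of_mem_stage (ρ := σ.symm) (fun x => ?_) (fun j hj => ?_) hf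
    · have hx : σ.symm (algebraMap F₀ K x) = algebraMap F₀ K (σ₀.symm x) := by
        rw [RingEquiv.symm_apply_eq, ht.extends_base, RingEquiv.apply_symm_apply]
      rw [hx]
      exact IntermediateField.algebraMap_mem _ _
    · have hδ := stage_mono t hj.le (ih j hj (ht.delta_mem j))
      rw [map_sub, σ.symm_apply_apply] at hδ
      rw [← sub_sub_cancel (t j) (σ.symm (t j))]
      exact sub_mem (mem_stage_of_lt t j hj) hδ

theorem IsSigmaTower.exists_isShift (ht : IsSigmaTower σ₀ σ t) (i : Fin n) :
    ∃ s, IsShift s (ht.delta i) σ (t i) :=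
  ⟨{  toFun := fun c => ⟨σ c, ht.map_mem_stage c.2⟩
      invFun := fun c => ⟨σ.symm c, ht.symm_map_mem_stage c.2⟩
      left_inv := fun _ => Subtype.ext (σ.symm_apply_apply _)
      right_inv := fun _ => Subtype.ext (σ.apply_symm_apply _)
      map_mul' := fun _ _ => Subtype.ext (map_mul σ _ _)
      map_add' := fun _ _ => Subtype.ext (map_add σ _ _) },
    fun _ => rfl, (add_sub_cancel (t i) (σ (t i))).symm⟩

theorem IsSigmaTower.delta_ne_zero (ht : IsSigmaTower σ₀ σ t) (i : Fin n) : ht.delta i ≠ 0 := by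
  intro h
  obtain ⟨c, -, hc⟩ := ht.constants_eq _ (sub_eq_zero.1 (congrArg Subtype.val h))
  refine ht.transcendental i ?_
  rw [← hc]
  exact isAlgebraic_algebraMap (A := K) (algebraMap F₀ (stage F₀ t i) c)

theorem IsSigmaTower.map_constants (ht : IsSigmaTower σ₀ σ t) (c : constants σ₀) :
    σ (algebraMap (constants σ₀) K c) = algebraMap (constants σ₀) K c :=
  (ht.extends_base c).trans (congrArg (algebraMap F₀ K) c.2)

theorem IsSigmaTower.exists_constants (ht : IsSigmaTower σ₀ σ t) {f : K} (hf : σ f = f) :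
    ∃ c : constants σ₀, algebraMap (constants σ₀) K c = f :=
  let ⟨c, hc, hcf⟩ := ht.constants_eq f hf
  ⟨⟨c, hc⟩, hcf⟩

/-- `y` arises from `t` by adding to each entry an element of the field generated by the previous
entries, so that `y` generates the same tower of fields. -/
def IsTriangularChange (F₀ : Type u) {K : Type v} [Field F₀] [Field K] [Algebra F₀ K] {n : ℕ}
    (t y : Fin n → K) : Prop :=
  ∀ j : Fin n, y j - t j ∈ stage F₀ t j

namespace IsTriangularChange

variable {y : Fin n → K}

theorem refl (t : Fin n → K) : IsTriangularChange F₀ t t := fun j => by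
  rw [sub_self]; exact zero_mem _

theorem stage_eq (h : IsTriangularChange F₀ t y) : stage F₀ y = stage F₀ t := by
  funext i
  refine le_antisymm (stage_le fun j hj => ?_) ?_
  · rw [← sub_add_cancel (y j) (t j)]
    exact add_mem (stage_mono t hj.le (h j)) (mem_stage_of_lt t j hj)
  · induction i using Nat.strong_induction_on with
    | _ i ih =>
      refine stage_le fun j hj => ?_
      rw [← sub_sub_cancel (y j) (t j)]
      exact sub_mem (mem_stage_of_lt y j hj) (stage_mono y hj.le (ih j hj (h j)))

theorem update_sub (h : IsTriangularChange F₀ t y) {i : Fin n} {g : K} (hg : g ∈ stage F₀ t i) :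
    IsTriangularChange F₀ t (Function.update y i (y i - g)) := by
  intro j
  rcases eq_or_ne j i with rfl | hj
  · rw [Function.update_self, sub_right_comm]
    exact sub_mem (h j) hg
  · rw [Function.update_of_ne hj]
    exact h j

theorem isSigmaTower (h : IsTriangularChange F₀ t y) (ht : IsSigmaTower σ₀ σ t) :
    IsSigmaTower σ₀ σ y where
  extends_base := ht.extends_base
  transcendental i := by
    rw [h.stage_eq]
    intro hy
    refine ht.transcendental i ?_
    rw [← sub_sub_cancel (y i) (t i)]
    exact hy.sub (isAlgebraic_algebraMap (A := K) (⟨_, h i⟩ : stage F₀ t i))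
  delta_mem i := by
    rw [h.stage_eq]
    have hδ : σ (y i) - y i = σ (y i - t i) - (y i - t i) + (σ (t i) - t i) := by
      rw [map_sub]; ring
    rw [hδ]
    exact add_mem (sub_mem (ht.map_mem_stage (h i)) (h i)) (ht.delta_mem i)
  generates := by rw [h.stage_eq]; exact ht.generates
  constants_eq := ht.constants_eq

end IsTriangularChange

end Stage

section CanonicalBasis

variable {F₀ : Type u} {K : Type v} [Field F₀] [Field K] [Algebra F₀ K]

section Product

variable {L : IntermediateField F₀ K} {t : K} {C : Type w} [Field C] [Algebra C K] {B : Set K}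

theorem linearIndepOn_image2_canonicalStep [Algebra C F₀] [IsScalarTower C F₀ K]
    (ht : Transcendental L t) (hBL : B ⊆ L) (hB : LinearIndepOn C id B) :
    LinearIndepOn C id (Set.image2 (· * ·) B (canonicalStep L t)) := by
  have hB' : LinearIndependent C fun b : B => (⟨b, hBL b.2⟩ : L) :=
    LinearIndependent.of_comp (inclusion C L) hB
  convert (linearIndependent_smul hB' (linearIndependent_canonicalFamily ht)).linearIndepOn_id
    using 1
  rw [← range_canonicalFamily]
  ext x
  constructor
  · rintro ⟨b, hb, _, ⟨k, rfl⟩, rfl⟩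
    exact ⟨(⟨b, hb⟩, k), rfl⟩
  · rintro ⟨⟨b, k⟩, rfl⟩
    exact ⟨b, b.2, _, ⟨k, rfl⟩, rfl⟩

theorem mem_span_image2_canonicalStep (ht : Transcendental L t)
    (hspan : ∀ f ∈ L, f ∈ Submodule.span C B) {f : K} (hf : f ∈ simpleAdjoin L t) :
    f ∈ Submodule.span C (Set.image2 (· * ·) B (canonicalStep L t)) := by
  obtain ⟨a, b, rfl⟩ := mem_simpleAdjoin_iff.1 hf
  have hstep := aeval_div_mem_span_canonicalFamily ht a b
  rw [range_canonicalFamily] at hstep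
  generalize aeval t a / aeval t b = f at hstep ⊢
  induction hstep using Submodule.closure_induction with
  | zero => exact zero_mem _
  | add x y _ _ hx hy => exact add_mem hx hy
  | smul_mem c x hx =>
    refine Submodule.span_mono ?_ (Submodule.apply_mem_span_image_of_mem_span
      (LinearMap.mulRight C x) (hspan c c.2))
    rintro _ ⟨b, hb, rfl⟩
    exact ⟨b, hb, x, hx, rfl⟩

end Product

variable {n : ℕ} {t : Fin n → K} {Θ₀ : Set F₀}

theorem canonicalBasis_succ (Θ₀ : Set F₀) (t : Fin n → K) (i : Fin n) :
    canonicalBasis Θ₀ t (i + 1) =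
      Set.image2 (· * ·) (canonicalBasis Θ₀ t i) (canonicalStep (stage F₀ t i) (t i)) :=
  dif_pos i.isLt

theorem canonicalBasis_mono (Θ₀ : Set F₀) (t : Fin n → K) : Monotone (canonicalBasis Θ₀ t) :=
  monotone_nat_of_le_succ fun i x hx => by
    rw [canonicalBasis]
    split_ifs with h
    · exact ⟨x, hx, 1, Or.inl ⟨0, (pow_zero _).symm⟩, mul_one x⟩
    · exact hx

theorem canonicalStep_subset_simpleAdjoin (L : IntermediateField F₀ K) (t : K) :
    canonicalStep L t ⊆ simpleAdjoin L t := by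
  rintro _ (⟨k, rfl⟩ | ⟨q, -, -, k, j, -, -, rfl⟩)
  · exact mem_simpleAdjoin_iff.2 ⟨X ^ k, 1, by rw [map_pow, aeval_X, map_one, div_one]⟩
  · exact mem_simpleAdjoin_iff.2 ⟨X ^ k, q ^ j, by rw [map_pow, aeval_X, map_pow]⟩

theorem canonicalBasis_subset_stage (i : ℕ) : canonicalBasis Θ₀ t i ⊆ stage F₀ t i := by
  induction i with
  | zero =>
    rintro _ ⟨x, -, rfl⟩
    exact IntermediateField.algebraMap_mem _ _
  | succ i ih =>
    rw [canonicalBasis]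
    split_ifs with h
    · rintro _ ⟨b, hb, c, hc, rfl⟩
      refine mul_mem (stage_mono t i.le_succ (ih hb)) ?_
      rw [stage_succ t ⟨i, h⟩]
      exact canonicalStep_subset_simpleAdjoin _ _ hc
    · exact ih.trans (stage_mono t i.le_succ)

variable {C : Type w} [Field C] [Algebra C F₀] [Algebra C K] [IsScalarTower C F₀ K]

theorem linearIndepOn_canonicalBasis (hli : LinearIndepOn C id Θ₀)
    (ht : ∀ i : Fin n, Transcendental (stage F₀ t i) (t i)) (i : ℕ) :
    LinearIndepOn C id (canonicalBasis Θ₀ t i) := by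
  induction i with
  | zero =>
    have h := (LinearIndependent.map' hli (IsScalarTower.toAlgHom C F₀ K).toLinearMap
      (LinearMap.ker_eq_bot.2 (algebraMap F₀ K).injective)).linearIndepOn_id
    rw [canonicalBasis, Set.image_eq_range]
    exact h
  | succ i ih =>
    rw [canonicalBasis]
    split_ifs with h
    · exact linearIndepOn_image2_canonicalStep (ht ⟨i, h⟩) (canonicalBasis_subset_stage i) ih
    · exact ih

theorem mem_span_canonicalBasis (hspan : ∀ f, f ∈ Submodule.span C Θ₀)
    (ht : ∀ i : Fin n, Transcendental (stage F₀ t i) (t i)) {i : ℕ} (hi : i ≤ n) :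
    ∀ f ∈ stage F₀ t i, f ∈ Submodule.span C (canonicalBasis Θ₀ t i) := by
  induction i with
  | zero =>
    intro f hf
    rw [stage_zero, IntermediateField.mem_bot] at hf
    obtain ⟨x, rfl⟩ := hf
    exact Submodule.apply_mem_span_image_of_mem_span
      (IsScalarTower.toAlgHom C F₀ K).toLinearMap (hspan x)
  | succ i ih =>
    intro f hf
    rw [stage_succ t ⟨i, hi⟩] at hf
    rw [canonicalBasis_succ Θ₀ t ⟨i, hi⟩]
    exact mem_span_image2_canonicalStep (ht ⟨i, hi⟩) (ih (Nat.le_of_succ_le hi)) hf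

end CanonicalBasis

theorem initialSegment_update {K : Type v} {n : ℕ} (t : Fin n → K) {i j : Fin n}
    (hij : i < j) (x : K) :
    initialSegment (Function.update t j x) i = initialSegment t i :=
  funext fun k => Function.update_of_ne
    (((Nat.lt_succ_iff.1 k.isLt).trans_lt hij).ne <| congrArg Fin.val ·) _ _

section Effective

variable {F₀ : Type u} {K : Type v} [Field F₀] [Field K] [Algebra F₀ K] {n : ℕ} {t : Fin n → K}
  {Θ₀ : Set F₀} {σ₀ : RingAut F₀}

theorem mem_stage_indicator {f : K} {i : ℕ} (hf : f ∈ stage F₀ t i) :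
    f ∈ stage F₀ t (indicator F₀ t f) :=
  Nat.sInf_mem (s := {i | f ∈ stage F₀ t i}) ⟨i, hf⟩

theorem indicator_le {f : K} {i : ℕ} (hf : f ∈ stage F₀ t i) : indicator F₀ t f ≤ i :=
  Nat.sInf_le hf

theorem exists_isEffective (hspan : ∀ f, f ∈ Submodule.span (constants σ₀) Θ₀)
    (ht : ∀ i : Fin n, Transcendental (stage F₀ t i) (t i)) {i : ℕ} (hi : i ≤ n) {r : K}
    (hr : r ∈ stage F₀ t i) (hr0 : r ≠ 0) : ∃ θ, IsEffective σ₀ Θ₀ t i r θ := by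
  have hle := indicator_le hr
  have hmem := mem_span_canonicalBasis (C := constants σ₀) hspan ht (hle.trans hi) r
    (mem_stage_indicator hr)
  rw [← Set.image_id (canonicalBasis Θ₀ t _), Finsupp.mem_span_image_iff_linearCombination] at hmem
  obtain ⟨l, hl, hlr⟩ := hmem
  have hstage (η : K) (hη : η ∈ l.support) : η ∈ stage F₀ t (indicator F₀ t r) :=
    canonicalBasis_subset_stage _ (hl hη)
  have hl0 : l.support.Nonempty := by
    rw [Finsupp.support_nonempty_iff]
    rintro rfl
    exact hr0 (hlr.symm.trans (map_zero _))
  obtain ⟨θ, hθ, hmax⟩ := l.support.exists_max_image (indicator F₀ t) hl0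
  have hrθ : r ∈ stage F₀ t (indicator F₀ t θ) := by
    rw [← hlr, Finsupp.linearCombination_apply]
    refine sum_mem fun η hη => ?_
    change l η • η ∈ _
    rw [← algebraMap_smul F₀ (l η) η]
    exact IntermediateField.smul_mem _
      (stage_mono t (hmax η hη) (mem_stage_indicator (hstage η hη)))
  exact ⟨θ, canonicalBasis_mono Θ₀ t hle (hl hθ), ⟨l θ, Finsupp.mem_support_iff.1 hθ, l,
    Finsupp.supported_mono (canonicalBasis_mono Θ₀ t hle) hl, hlr, rfl⟩,
    (indicator_le (hstage θ hθ)).antisymm (indicator_le hrθ)⟩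

theorem stage_initialSegment (t : Fin n → K) (i : Fin n) {k : ℕ} (hk : k ≤ i + 1) :
    stage F₀ (initialSegment t i) k = stage F₀ t k :=
  le_antisymm (stage_le fun _ hj => mem_stage_of_lt t _ hj) (stage_le fun j hj =>
    mem_stage_of_lt (initialSegment t i) ⟨j, hj.trans_le hk⟩ hj)

theorem canonicalBasis_initialSegment (t : Fin n → K) (i : Fin n) {k : ℕ} (hk : k ≤ i + 1) :
    canonicalBasis Θ₀ (initialSegment t i) k = canonicalBasis Θ₀ t k := by
  induction k with
  | zero => rfl
  | succ k ih =>
    rw [canonicalBasis_succ Θ₀ _ ⟨k, hk⟩,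
      canonicalBasis_succ Θ₀ t ⟨k, Nat.lt_of_lt_of_le hk i.isLt⟩,
      ih (Nat.le_of_succ_le hk), stage_initialSegment t i (Nat.le_of_succ_le hk)]
    rfl

theorem indicator_initialSegment (t : Fin n → K) (i : Fin n) {f : K} (hf : f ∈ stage F₀ t i) :
    indicator F₀ (initialSegment t i) f = indicator F₀ t f := by
  have hi : (i : ℕ) ≤ i + 1 := Nat.le_succ _
  have hf' : f ∈ stage F₀ (initialSegment t i) i := by rwa [stage_initialSegment t i hi]
  apply le_antisymm
  · apply indicator_le
    rw [stage_initialSegment t i ((indicator_le hf).trans hi)]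
    exact mem_stage_indicator hf
  · apply indicator_le
    rw [← stage_initialSegment t i ((indicator_le hf').trans hi)]
    exact mem_stage_indicator hf'

theorem isEffective_initialSegment_iff (t : Fin n → K) (i : Fin n) {r θ : K}
    (hr : r ∈ stage F₀ t i) :
    IsEffective σ₀ Θ₀ (initialSegment t i) i r θ ↔ IsEffective σ₀ Θ₀ t i r θ := by
  rw [IsEffective, IsEffective, canonicalBasis_initialSegment t i (Nat.le_succ _),
    indicator_initialSegment t i hr]
  refine and_congr_right fun hθ => ?_
  rw [indicator_initialSegment t i (canonicalBasis_subset_stage _ hθ)]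

end Effective

section Construction

variable {F₀ : Type u} {K : Type v} [Field F₀] [Field K] [Algebra F₀ K] {σ₀ : RingAut F₀}
  {Θ₀ : Set F₀} {σ : RingAut K} {n : ℕ} {y : Fin n → K}

theorem Selection.isRepresentatives_reps (sel : Selection.{u, v} σ₀ Θ₀)
    (hy : IsSigmaTower σ₀ σ y) (i : Fin n) :
    IsRepresentatives σ (stage F₀ y i) (y i) (sel.reps σ (initialSegment y i)) := by
  obtain ⟨s, hshift⟩ := hy.exists_isShift i
  have h := sel.reps_spec σ (initialSegment y i)
  rw [stage_initialSegment y i (Nat.le_succ _)] at h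
  exact h (exists_isRepresentatives hshift.base _)

theorem Selection.isEffective_elt (sel : Selection.{u, v} σ₀ Θ₀) (hy : IsSigmaTower σ₀ σ y)
    (hspan : ∀ f, f ∈ Submodule.span (constants σ₀) Θ₀) (i : Fin n) {r : K}
    (hr : r ∈ stage F₀ y i) (hr0 : r ≠ 0) :
    IsEffective σ₀ Θ₀ (initialSegment y i) i r (sel.elt σ (initialSegment y i) r) := by
  obtain ⟨θ, hθ⟩ := exists_isEffective hspan hy.transcendental i.isLt.le hr hr0
  exact sel.elt_spec σ (initialSegment y i) r ⟨θ, (isEffective_initialSegment_iff y i hr).2 hθ⟩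

/-- The relation between consecutive complete reductions `φ` on `L` and `φ'` on `L'` in a well
generated tower, where `y` lists the generators of `L'` and `δ` is the difference of the last one.
The fields are variables, not stages of `y`, so that a reduction survives a change of generators. -/
structure IsReductionStep (sel : Selection.{u, v} σ₀ Θ₀) (σ : RingAut K) {m : ℕ}
    (y : Fin (m + 1) → K) {L L' : IntermediateField F₀ K} (φ : L →ₗ[constants σ₀] L)
    (φ' : L' →ₗ[constants σ₀] L') (δ : L) : Prop where
  delta_eq : (δ : K) = σ (y (Fin.last m)) - y (Fin.last m)
  delta_mem : δ ∈ LinearMap.range φ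
  representatives : IsRepresentatives σ L (y (Fin.last m)) (sel.reps σ y)
  effective : IsEffective σ₀ Θ₀ y m (φ δ) (sel.elt σ y (φ δ))
  complete : IsCompleteReduction (summableIn σ L') φ'
  image_eq : {x : K | ∃ z ∈ LinearMap.range φ', (z : K) = x} =
    Set.image2 (· + ·) (properComplement L (y (Fin.last m)) (sel.reps σ y))
      (polyComplement L (y (Fin.last m)) φ (canonicalBasis Θ₀ y m) (sel.elt σ y (φ δ)))

theorem exists_isReductionStep [CharZero F₀] (sel : Selection.{u, v} σ₀ Θ₀)
    (hy : IsSigmaTower σ₀ σ y) (hli : LinearIndepOn (constants σ₀) id Θ₀)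
    (hspan : ∀ f, f ∈ Submodule.span (constants σ₀) Θ₀) (i : Fin n)
    {L L' : IntermediateField F₀ K} (hL : stage F₀ y i = L) (hL' : stage F₀ y (i + 1) = L')
    {φ : L →ₗ[constants σ₀] L} (hφ : IsCompleteReduction (summableIn σ L) φ) {δ : L}
    (hδ : (δ : K) = σ (y i) - y i) (hδφ : δ ∈ LinearMap.range φ) :
    ∃ φ' : L' →ₗ[constants σ₀] L', IsReductionStep sel σ (initialSegment y i) φ φ' δ := by
  subst hL
  rw [stage_succ] at hL'
  subst hL'
  obtain rfl : δ = hy.delta i := Subtype.ext hδ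
  have : CharZero (stage F₀ y i) := charZero_of_injective_algebraMap (algebraMap F₀ _).injective
  obtain ⟨s, hshift⟩ := hy.exists_isShift i
  have htr := hy.transcendental i
  have hφδ : φ (hy.delta i) = hy.delta i := hφ.apply_of_mem_range hδφ
  have hne : (φ (hy.delta i) : K) ≠ 0 := by
    rw [hφδ]
    exact fun h => hy.delta_ne_zero i (Subtype.ext h)
  have hreps := sel.isRepresentatives_reps hy i
  have heff := sel.isEffective_elt hy hspan i (φ (hy.delta i)).2 hne
  have hbasis := canonicalBasis_initialSegment (Θ₀ := Θ₀) y i (Nat.le_succ _)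
  obtain ⟨e, he, hcoord⟩ := heff.2.1
  rw [hbasis] at hcoord
  have hW := isDeltaComplement_reducedKernel hshift.base hy.map_constants
    (fun _ => hy.exists_constants) hφ (linearIndepOn_canonicalBasis hli hy.transcendental i)
    (mem_span_canonicalBasis hspan hy.transcendental i.isLt.le) he hcoord
  obtain ⟨φ', hcomplete, himage⟩ := exists_isCompleteReduction_simpleAdjoin htr hshift
    hy.map_constants (fun f hf => (hy.exists_constants hf).imp' (algebraMap _ _) fun _ => id)
    hW hreps
  rw [polynomialsOver_reducedKernel, ← hbasis] at himage
  exact ⟨φ', hδ, hδφ, hreps, heff, hcomplete, himage⟩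

/-- `φ 0, …, φ i` are the complete reductions of a tower generated by `y` with stages `A`, and the
first `i` generators satisfy the condition of a well generated tower. -/
structure IsPartialReduction (φ₀ : F₀ →ₗ[constants σ₀] F₀) (sel : Selection.{u, v} σ₀ Θ₀)
    (σ : RingAut K) (y : Fin n → K) {A : ℕ → IntermediateField F₀ K}
    (φ : ∀ k, A k →ₗ[constants σ₀] A k) (i : ℕ) : Prop where
  base : ∀ f : F₀, φ 0 (algebraMap F₀ (A 0) f) = algebraMap F₀ (A 0) (φ₀ f)
  complete : IsCompleteReduction (summableIn σ (A i)) (φ i)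
  step : ∀ j : Fin n, (j : ℕ) < i →
    ∃ δ, IsReductionStep sel σ (initialSegment y j) (φ j) (φ (j + 1)) δ

variable {φ₀ : F₀ →ₗ[constants σ₀] F₀} {sel : Selection.{u, v} σ₀ Θ₀}

theorem IsPartialReduction.isWellGenerated {A : ℕ → IntermediateField F₀ K}
    {φ : ∀ k, A k →ₗ[constants σ₀] A k} (h : IsPartialReduction φ₀ sel σ y φ n)
    (hA : A = stage F₀ y) (hy : IsSigmaTower σ₀ σ y) : IsWellGenerated φ₀ sel hy := by
  subst hA
  have hstep (i : Fin n) :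
      IsReductionStep sel σ (initialSegment y i) (φ i) (φ (i + 1)) (hy.delta i) := by
    obtain ⟨δ, hδ⟩ := h.step i i.isLt
    obtain rfl : δ = hy.delta i := Subtype.ext hδ.delta_eq
    exact hδ
  refine ⟨φ, ⟨h.base, fun i => (hstep i).representatives, fun i => ?_,
    fun i => (hstep i).complete, fun i => ?_⟩, fun i => (hstep i).delta_mem⟩
  · exact (isEffective_initialSegment_iff y i (φ i _).2).1 (hstep i).effective
  · rw [← canonicalBasis_initialSegment y i (Nat.le_succ _)]
    exact (hstep i).image_eq

theorem IsPartialReduction.update {A : ℕ → IntermediateField F₀ K}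
    {φ : ∀ k, A k →ₗ[constants σ₀] A k} {i : Fin n} (h : IsPartialReduction φ₀ sel σ y φ i)
    {x : K} {φ' : A (i + 1) →ₗ[constants σ₀] A (i + 1)} {δ : A i}
    (hφ' : IsReductionStep sel σ (initialSegment (Function.update y i x) i) (φ i) φ' δ) :
    IsPartialReduction φ₀ sel σ (Function.update y i x) (Function.update φ (i + 1) φ') (i + 1) where
  base := by
    rw [Function.update_of_ne (Nat.succ_ne_zero i).symm]
    exact h.base
  complete := by
    rw [Function.update_self]
    exact hφ'.complete
  step j hj := by
    rcases (Nat.lt_succ_iff.1 hj).eq_or_lt with hji | hji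
    · obtain rfl : j = i := Fin.ext hji
      refine ⟨δ, ?_⟩
      rw [Function.update_of_ne (Nat.succ_ne_self j).symm, Function.update_self]
      exact hφ'
    · rw [initialSegment_update y hji, Function.update_of_ne (by omega),
        Function.update_of_ne (by omega)]
      exact h.step j hji

theorem exists_isCompleteReduction_bot (hφ₀ : IsCompleteReduction (summable σ₀) φ₀)
    (hσ : ∀ x : F₀, σ (algebraMap F₀ K x) = algebraMap F₀ K (σ₀ x))
    {L : IntermediateField F₀ K} (hL : L = ⊥) : ∃ φ : L →ₗ[constants σ₀] L,
      (∀ f : F₀, φ (algebraMap F₀ L f) = algebraMap F₀ L (φ₀ f)) ∧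
        IsCompleteReduction (summableIn σ L) φ := by
  subst hL
  let e : F₀ ≃ₗ[constants σ₀] (⊥ : IntermediateField F₀ K) :=
    (IntermediateField.botEquiv F₀ K).symm.toLinearEquiv.restrictScalars (constants σ₀)
  have he (f : F₀) : e f = algebraMap F₀ (⊥ : IntermediateField F₀ K) f :=
    IntermediateField.botEquiv_symm f
  have hsummable : e.symm ⁻¹' summable σ₀ = summableIn σ ⊥ := by
    ext f
    obtain ⟨f, rfl⟩ := e.surjective f
    rw [Set.mem_preimage, e.symm_apply_apply]
    refine (e.surjective.exists.trans (exists_congr fun g => ?_)).symm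
    rw [he, he, IntermediateField.coe_algebraMap_apply, IntermediateField.coe_algebraMap_apply,
      hσ, ← map_sub, (algebraMap F₀ K).injective.eq_iff]
  refine ⟨e.conj φ₀, fun f => ?_, hsummable ▸ hφ₀.conj e⟩
  rw [← he, ← he, LinearEquiv.conj_apply_apply, e.symm_apply_apply]

variable {t : Fin n → K}

theorem exists_isPartialReduction_zero (hφ₀ : IsCompleteReduction (summable σ₀) φ₀)
    (sel : Selection.{u, v} σ₀ Θ₀) (ht : IsSigmaTower σ₀ σ t) :
    ∃ φ : ∀ k, stage F₀ t k →ₗ[constants σ₀] stage F₀ t k,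
      IsPartialReduction φ₀ sel σ t φ 0 := by
  obtain ⟨φ, hbase, hcomplete⟩ :=
    exists_isCompleteReduction_bot hφ₀ ht.extends_base (stage_zero t)
  refine ⟨Function.update (fun _ => 0) 0 φ, ?_, ?_, fun j hj => absurd hj (Nat.not_lt_zero _)⟩
  · rw [Function.update_self]
    exact hbase
  · rw [Function.update_self]
    exact hcomplete

theorem IsPartialReduction.exists_succ [CharZero F₀]
    {φ : ∀ k, stage F₀ t k →ₗ[constants σ₀] stage F₀ t k} {i : Fin n}
    (h : IsPartialReduction φ₀ sel σ y φ i) (hty : IsTriangularChange F₀ t y)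
    (ht : IsSigmaTower σ₀ σ t) (hli : LinearIndepOn (constants σ₀) id Θ₀)
    (hspan : ∀ f, f ∈ Submodule.span (constants σ₀) Θ₀) :
    ∃ y', IsTriangularChange F₀ t y' ∧
      ∃ φ' : ∀ k, stage F₀ t k →ₗ[constants σ₀] stage F₀ t k,
        IsPartialReduction φ₀ sel σ y' φ' (i + 1) := by
  let d : stage F₀ t i := ⟨σ (y i) - y i, hty.stage_eq ▸ (hty.isSigmaTower ht).delta_mem i⟩
  obtain ⟨g, hg⟩ := h.complete.1 d
  have hty' := hty.update_sub g.2
  have hδ : (φ i d : K) = σ (Function.update y i (y i - g) i) -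
      Function.update y i (y i - g) i := by
    rw [Function.update_self, map_sub, sub_sub_sub_comm, ← hg]
    exact (sub_sub_self _ _).symm
  obtain ⟨φ', hφ'⟩ := exists_isReductionStep sel (hty'.isSigmaTower ht) hli hspan i
    (congrFun hty'.stage_eq i) (congrFun hty'.stage_eq (i + 1)) h.complete hδ ⟨d, rfl⟩
  exact ⟨_, hty', _, h.update hφ'⟩

theorem exists_isPartialReduction [CharZero F₀] (hφ₀ : IsCompleteReduction (summable σ₀) φ₀)
    (sel : Selection.{u, v} σ₀ Θ₀) (ht : IsSigmaTower σ₀ σ t)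
    (hli : LinearIndepOn (constants σ₀) id Θ₀)
    (hspan : ∀ f, f ∈ Submodule.span (constants σ₀) Θ₀) {i : ℕ} (hi : i ≤ n) :
    ∃ y, IsTriangularChange F₀ t y ∧
      ∃ φ : ∀ k, stage F₀ t k →ₗ[constants σ₀] stage F₀ t k,
        IsPartialReduction φ₀ sel σ y φ i := by
  induction i with
  | zero => exact ⟨t, .refl t, exists_isPartialReduction_zero hφ₀ sel ht⟩
  | succ i ih =>
    obtain ⟨y, hty, φ, hφ⟩ := ih (Nat.le_of_succ_le hi)
    exact hφ.exists_succ (i := ⟨i, hi⟩) hty ht hli hspan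

theorem IsSigmaTower.exists_isWellGenerated [CharZero F₀] (ht : IsSigmaTower σ₀ σ t)
    (hφ₀ : IsCompleteReduction (summable σ₀) φ₀) (sel : Selection.{u, v} σ₀ Θ₀)
    (hli : LinearIndepOn (constants σ₀) id Θ₀)
    (hspan : ∀ f, f ∈ Submodule.span (constants σ₀) Θ₀) :
    ∃ y, IsTriangularChange F₀ t y ∧ ∃ hy : IsSigmaTower σ₀ σ y, IsWellGenerated φ₀ sel hy := by
  obtain ⟨y, hty, φ, hφ⟩ := exists_isPartialReduction hφ₀ sel ht hli hspan le_rfl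
  exact ⟨y, hty, hty.isSigmaTower ht, hφ.isWellGenerated hty.stage_eq.symm _⟩

end Construction

end SigmaTower

theorem mainTheorem11 {F₀ : Type u} [Field F₀] [CharZero F₀] (σ₀ : RingAut F₀)
    (φ₀ : F₀ →ₗ[SigmaTower.constants σ₀] F₀)
    (hφ₀ : SigmaTower.IsCompleteReduction (SigmaTower.summable σ₀) φ₀)
    {ι : Type w} (Θ₀ : Module.Basis ι (SigmaTower.constants σ₀) F₀)
    (sel : SigmaTower.Selection.{u, v} σ₀ (Set.range Θ₀))
    {F : Type v} [Field F] [Algebra F₀ F] (σ : RingAut F) (n : ℕ) (t : Fin n → F)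
    (ht : SigmaTower.IsSigmaTower σ₀ σ t) :
    ∃ (K : Type v) (_ : Field K) (_ : Algebra F₀ K) (σK : RingAut K) (y : Fin n → K)
      (hy : SigmaTower.IsSigmaTower σ₀ σK y),
      SigmaTower.IsWellGenerated φ₀ sel hy ∧
      ∃ τ : F ≃ₐ[F₀] K, ∀ x : F, τ (σ x) = σK (τ x) := by
  obtain ⟨y, -, hy, hgen⟩ := ht.exists_isWellGenerated hφ₀ sel
    Θ₀.linearIndependent.linearIndepOn_id fun f => Θ₀.span_eq ▸ Submodule.mem_top
  exact ⟨F, inferInstance, inferInstance, σ, y, hy, hgen, AlgEquiv.refl, fun _ => rfl⟩
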